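/- **Setting.** For $n\in\mathbb{N}$ and $0<\lambda_2<\lambda_1<\sqrt n\,\lambda_2$ let $D=\{s\in\mathbb{R}^n_{\ge0}:\|s\|_1=\lambda_1,\ \|s\|_2=\lambda_2\}$ and, for $x\in\mathbb{R}^n_{\ge 0}$, $\operatorname{proj}_D(x)=\{y\in D:\|y-x\|_2\le\|z-x\|_2\ \forall z\in D\}$. With $x_{\max}=\max_i x_i$ put, for $\alpha<x_{\max}$, $$\Psi(\alpha)=\frac{\|\max(x-\alpha,0)\|_1}{\|\max(x-\alpha,0)\|_2}-\frac{\lambda_1}{\lambda_2},$$ the maximum being taken entry by entry. **Auxiliary evaluation** $\mathrm{aux}(\alpha)$. One scan through $x$ computes $d=\#\{i:x_i>\alpha\}$, $\ell_1=\sum_{x_i>\alpha}x_i$, $\ell_2^2=\sum_{x_i>\alpha}x_i^2$, the largest number $x_j\le\alpha$ in $\{0\}\cup\{x_i\}_i$ and the smallest entry $x_k>\alpha$. With $L_1=\ell_1-d\alpha$ and $Q=\ell_2^2-2\alpha\ell_1+d\alpha^2$ it returns $d,\ell_1,\ell_2^2$ and $$\Psi=\tfrac{L_1}{\sqrt{Q}}-\tfrac{\lambda_1}{\lambda_2},\quad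 \Psi'=\tfrac{1}{\sqrt{Q}}\Big(\tfrac{L_1^2}{Q}-d\Big),\quad \Psi''=\tfrac{3\Psi'L_1}{Q},\quad \tilde\Psi=\tfrac{L_1^2}{Q}-\tfrac{\lambda_1^2}{\lambda_2^2},\quad \tilde\Psi'=\tfrac{2L_1}{\sqrt{Q}}\Psi',$$ and sets $\mathit{finished}$ to the truth value of: $\lambda_2(\ell_1-dx_j)\ge\lambda_1\sqrt{\ell_2^2-2x_j\ell_1+dx_j^2}$ and $\lambda_2(\ell_1-dx_k)<\lambda_1\sqrt{\ell_2^2-2x_k\ell_1+dx_k^2}$. **Algorithm.** The input is $x,\lambda_1,\lambda_2$ and a solver: Bisection, Newton, NewtonSqr or Halley. 1. Call $\mathrm{aux}(0)$. If $\Psi(0)\le0$, set $d:=n$ and go to step 3. 2. Set $\mathit{lo}:=0$, $\mathit{up}:=\max\{x_i:x_i\ne x_{\max}\}$, $\alpha:=\mathit{lo}+\frac12(\mathit{up}-\mathit{lo})$ and call $\mathrm{aux}(\alpha)$. While not $\mathit{finished}$: if $\Psi(\alpha)>0$ set $\mathit{lo}:=\alpha$, otherwise $\mathit{up}:=\alpha$;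 then update $\alpha$ and call $\mathrm{aux}(\alpha)$. The updates are $\alpha:=\mathit{lo}+\frac12(\mathit{up}-\mathit{lo})$ for Bisection, $\alpha:=\alpha-\Psi/\Psi'$ for Newton, $\alpha:=\alpha-\tilde\Psi/\tilde\Psi'$ for NewtonSqr, and $\alpha:=\alpha-\Psi/(h\Psi')$ with $h=\max(\tfrac12,\min(\tfrac32,1-\Psi\Psi''/(2\Psi'^2)))$ for Halley. For the last three, if the new $\alpha$ satisfies $\alpha<\mathit{lo}$ or $\alpha>\mathit{up}$, then $\alpha:=\mathit{lo}+\frac12(\mathit{up}-\mathit{lo})$ instead. 3. Set $\alpha:=\frac1d\Big(\ell_1-\lambda_1\sqrt{\frac{d\ell_2^2-\ell_1^2}{d\lambda_2^2-\lambda_1^2}}\Big)$. In place, replace each $x_i$ by $\max(x_i-\alpha,0)$, accumulating $\rho=\sum_i\max(x_i-\alpha,0)^2$, and then each $x_i$ by $\frac{\lambda_2}{\sqrt\rho}x_i$. Return $x$. The algorithm runs on a real-number machine with exact arithmetic: scalar registers, one array of length $n$ that holds $x$ and is overwritten by the result, and one pointer into it. Every read, arithmetic operation, square root, comparison, assignment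 and pointer move is one operation. A division by zero or a square root of a negative number blocks the machine, and a blocked run does not halt. **Theorem.** There are absolute constants $C$ and $S$ such that for each of the four solvers the algorithm uses at most $S$ memory cells besides the array, and the following holds for all $n$, all $0<\lambda_2<\lambda_1<\sqrt n\,\lambda_2$ and all $x\in\mathbb{R}^n_{\ge0}$ for which $\operatorname{proj}_D(x)=\{p\}$ is a single point. 1. For every solver, if the algorithm halts, having called $\mathrm{aux}$ exactly $k$ times, then it returns $p$, after at most $C\,n\,k$ operations. 2. If $\Psi(0)\le0$, then for every solver the algorithm halts with $k=1$, hence it returns $p$ after at most $Cn$ operations. 3. Let $\Psi(0)>0$, let the solver be Bisection, and let $m\lambda_2^2\neq\lambda_1^2$, where $m$ is the number of indices $i$ with $x_i=x_{\max}$. Then the algorithm halts and returns $p$. Moreover, let $u$ be the second largest among the distinct values of the entries of $x$. There are $a<b<x_{\max}$ such that $a$ is $0$ or an entry of $x$, $b$ is an entry of $x$, no entry lies strictly between $a$ and $b$, $\Psi(a)\ge0>\Psi(b)$, and $$k\le 2+\log_2\frac{u}{b-a},\qquad \text{number of operations}\ \le\ C\,n\left(2+\log_2\frac{u}{b-a}\right).$$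 Thus for Bisection the number of operations is linear in $n$ with a constant that depends only on a lower bound for $(b-a)/u$, the relative length of the interval that has to be found. -/

import Mathlib

open scoped BigOperators

/-! ## The target set and Euclidean projections -/

/-- The non-negative vectors with Manhattan norm `lam1` and Euclidean norm `lam2`. -/
def sparseSet (n : ℕ) (lam1 lam2 : ℝ) : Set (EuclideanSpace ℝ (Fin n)) :=
  {s | (∀ i, 0 ≤ s i) ∧ ∑ i, |s i| = lam1 ∧ ‖s‖ = lam2}

/-- The set of all Euclidean projections of `x` onto `M`. -/
def projSet {n : ℕ} (M : Set (EuclideanSpace ℝ (Fin n))) (x : EuclideanSpace ℝ (Fin n)) :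
    Set (EuclideanSpace ℝ (Fin n)) :=
  {y | y ∈ M ∧ ∀ z ∈ M, ‖y - x‖ ≤ ‖z - x‖}

/-! ## The auxiliary function and the interval that root-finding has to hit -/

/-- The auxiliary function `Ψ(α) = ‖max(x - α, 0)‖₁ / ‖max(x - α, 0)‖₂ - lam1 / lam2`
(meaningful where `α` is smaller than the largest entry of `x`). -/
noncomputable def auxPsi {n : ℕ} (x : EuclideanSpace ℝ (Fin n)) (lam1 lam2 α : ℝ) : ℝ :=
  (∑ i, max (x i - α) 0) / Real.sqrt (∑ i, (max (x i - α) 0) ^ 2) - lam1 / lam2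

/-- `u` is the second largest among the distinct values of the entries of `x`. -/
def IsSecondMax {n : ℕ} (x : EuclideanSpace ℝ (Fin n)) (u : ℝ) : Prop :=
  IsGreatest {v | (∃ i, x i = v) ∧ ∃ j, v < x j} u

/-- The multiplicity of the largest entry of `x`. -/
noncomputable def maxMult {n : ℕ} (x : EuclideanSpace ℝ (Fin n)) : ℕ :=
  {i | ∀ j, x j ≤ x i}.ncard

/-- `a < b` are neighbours among `0` and the entries of `x`, with `b` below the largest entry,
such that `Ψ(a) ≥ 0` and `Ψ(b) < 0`. -/
def IsRootBracket {n : ℕ} (x : EuclideanSpace ℝ (Fin n)) (lam1 lam2 a b : ℝ) : Prop :=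
  (a = 0 ∨ ∃ i, x i = a) ∧ (∃ i, x i = b) ∧ (∃ i, b < x i) ∧ 0 ≤ a ∧ a < b ∧
    (∀ i, x i ≤ a ∨ b ≤ x i) ∧ 0 ≤ auxPsi x lam1 lam2 a ∧ auxPsi x lam1 lam2 b < 0

/-! ## The machine: a real RAM with finitely many named scalar registers, and one pointer into
the array that holds the vector.  There is no other memory. -/

/-- The scalar registers. -/
inductive Reg where
  | lam1 | lam2 | alpha | l1 | l2sq | d | xj | dxj | xk | dxk | t
  | l1a | l2asq | psi | dpsi | ddpsi | psit | dpsit | finished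
  | lo | up | xmax | h | rho
  deriving DecidableEq

/-- A machine state: the registers, the pointer, and the array. -/
structure State (n : ℕ) where
  reg : Reg → ℝ
  idx : ℕ
  arr : Fin n → ℝ

/-- Arithmetic expressions. `cell` is the array entry under the pointer, `len` is the
dimension `n`. -/
inductive Expr where
  | reg (r : Reg) | lit (k : ℕ) | cell | len
  | add (a b : Expr) | sub (a b : Expr) | mul (a b : Expr) | div (a b : Expr)
  | sqrt (a : Expr) | max (a b : Expr) | min (a b : Expr)

namespace Expr

instance : Add Expr := ⟨Expr.add⟩
instance : Sub Expr := ⟨Expr.sub⟩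
instance : Mul Expr := ⟨Expr.mul⟩
instance : Div Expr := ⟨Expr.div⟩
instance (k : ℕ) : OfNat Expr k := ⟨Expr.lit k⟩
instance : Coe Reg Expr := ⟨Expr.reg⟩

/-- The value of an expression. -/
noncomputable def eval {n : ℕ} (s : State n) : Expr → ℝ
  | .reg r => s.reg r
  | .lit k => (k : ℝ)
  | .cell => if hi : s.idx < n then s.arr ⟨s.idx, hi⟩ else 0
  | .len => (n : ℝ)
  | .add a b => eval s a + eval s b
  | .sub a b => eval s a - eval s b
  | .mul a b => eval s a * eval s b
  | .div a b => eval s a / eval s b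
  | .sqrt a => Real.sqrt (eval s a)
  | .max a b => Max.max (eval s a) (eval s b)
  | .min a b => Min.min (eval s a) (eval s b)

/-- The expression can be evaluated: the pointer is inside the array wherever the array is read,
no division by zero, no square root of a negative number.  The machine is stuck otherwise. -/
def Ok {n : ℕ} (s : State n) : Expr → Prop
  | .reg _ => True
  | .lit _ => True
  | .cell => s.idx < n
  | .len => True
  | .add a b => Ok s a ∧ Ok s b
  | .sub a b => Ok s a ∧ Ok s b
  | .mul a b => Ok s a ∧ Ok s b
  | .div a b => Ok s a ∧ Ok s b ∧ eval s b ≠ 0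
  | .sqrt a => Ok s a ∧ 0 ≤ eval s a
  | .max a b => Ok s a ∧ Ok s b
  | .min a b => Ok s a ∧ Ok s b

/-- Number of operations for one evaluation: every read and every arithmetic operation counts
one. -/
def ops : Expr → ℕ
  | .reg _ => 1
  | .lit _ => 1
  | .cell => 1
  | .len => 1
  | .add a b => ops a + ops b + 1
  | .sub a b => ops a + ops b + 1
  | .mul a b => ops a + ops b + 1
  | .div a b => ops a + ops b + 1
  | .sqrt a => ops a + 1
  | .max a b => ops a + ops b + 1
  | .min a b => ops a + ops b + 1

/-- The registers that occur in an expression. -/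
def registers : Expr → Finset Reg
  | .reg r => {r}
  | .lit _ => ∅
  | .cell => ∅
  | .len => ∅
  | .add a b => registers a ∪ registers b
  | .sub a b => registers a ∪ registers b
  | .mul a b => registers a ∪ registers b
  | .div a b => registers a ∪ registers b
  | .sqrt a => registers a
  | .max a b => registers a ∪ registers b
  | .min a b => registers a ∪ registers b

end Expr

/-- Boolean tests. `inRange` tests whether the pointer is inside the array. -/
inductive Test where
  | lt (a b : Expr) | le (a b : Expr) | eq (a b : Expr) | inRange
  | and (p q : Test) | or (p q : Test) | not (p : Test)

namespace Test

/-- The truth value of a test. -/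
def Holds {n : ℕ} (s : State n) : Test → Prop
  | .lt a b => a.eval s < b.eval s
  | .le a b => a.eval s ≤ b.eval s
  | .eq a b => a.eval s = b.eval s
  | .inRange => s.idx < n
  | .and p q => Holds s p ∧ Holds s q
  | .or p q => Holds s p ∨ Holds s q
  | .not p => ¬ Holds s p

/-- All expressions in the test can be evaluated. -/
def Ok {n : ℕ} (s : State n) : Test → Prop
  | .lt a b => a.Ok s ∧ b.Ok s
  | .le a b => a.Ok s ∧ b.Ok s
  | .eq a b => a.Ok s ∧ b.Ok s
  | .inRange => True
  | .and p q => Ok s p ∧ Ok s q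
  | .or p q => Ok s p ∧ Ok s q
  | .not p => Ok s p

/-- Number of operations for one evaluation of the test. -/
def ops : Test → ℕ
  | .lt a b => a.ops + b.ops + 1
  | .le a b => a.ops + b.ops + 1
  | .eq a b => a.ops + b.ops + 1
  | .inRange => 1
  | .and p q => ops p + ops q + 1
  | .or p q => ops p + ops q + 1
  | .not p => ops p + 1

/-- The registers that occur in a test. -/
def registers : Test → Finset Reg
  | .lt a b => a.registers ∪ b.registers
  | .le a b => a.registers ∪ b.registers
  | .eq a b => a.registers ∪ b.registers
  | .inRange => ∅
  | .and p q => registers p ∪ registers q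
  | .or p q => registers p ∪ registers q
  | .not p => registers p

end Test

/-- Programs. `store e` writes to the array entry under the pointer, `rewind` moves the pointer to
the first entry, `advance` to the next one; `probe` does nothing and is used to count how often a
marked piece of code is entered. -/
inductive Cmd where
  | skip
  | probe
  | assign (r : Reg) (e : Expr)
  | store (e : Expr)
  | rewind
  | advance
  | seq (c c' : Cmd)
  | ite (p : Test) (c c' : Cmd)
  | loop (p : Test) (c : Cmd)

namespace Cmd

/-- A list of commands, carried out one after the other. -/
def block : List Cmd → Cmd
  | [] => .skip
  | c :: cs => .seq c (block cs)

/-- Carry out `c` for each entry of the array, from the first to the last. -/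
def forCells (c : Cmd) : Cmd :=
  .seq .rewind (.loop .inRange (.seq c .advance))

/-- The registers that occur in a program. -/
def registers : Cmd → Finset Reg
  | .skip => ∅
  | .probe => ∅
  | .assign r e => {r} ∪ e.registers
  | .store e => e.registers
  | .rewind => ∅
  | .advance => ∅
  | .seq c c' => registers c ∪ registers c'
  | .ite p c c' => p.registers ∪ registers c ∪ registers c'
  | .loop p c => p.registers ∪ registers c

/-- The number of memory cells that a program uses besides the array with the vector: its scalar
registers, and the pointer. -/
def space (c : Cmd) : ℕ := (registers c).card + 1

end Cmd

/-- `Exec c s s' t k`: started in state `s`, the program `c` halts in state `s'` after `t`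
operations, having passed `k` times through a `probe`. -/
inductive Exec {n : ℕ} : Cmd → State n → State n → ℕ → ℕ → Prop where
  | skip (s : State n) : Exec .skip s s 0 0
  | probe (s : State n) : Exec .probe s s 0 1
  | assign (s : State n) (r : Reg) (e : Expr) (ok : e.Ok s) :
      Exec (.assign r e) s { s with reg := Function.update s.reg r (e.eval s) } (e.ops + 1) 0
  | store (s : State n) (e : Expr) (ok : e.Ok s) (hi : s.idx < n) :
      Exec (.store e) s { s with arr := Function.update s.arr ⟨s.idx, hi⟩ (e.eval s) }
        (e.ops + 1) 0
  | rewind (s : State n) : Exec .rewind s { s with idx := 0 } 1 0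
  | advance (s : State n) : Exec .advance s { s with idx := s.idx + 1 } 1 0
  | seq {c c' : Cmd} {s s' s'' : State n} {t t' k k' : ℕ}
      (h : Exec c s s' t k) (h' : Exec c' s' s'' t' k') :
      Exec (.seq c c') s s'' (t + t') (k + k')
  | iteTrue {p : Test} {c c' : Cmd} {s s' : State n} {t k : ℕ} (ok : p.Ok s) (hp : p.Holds s)
      (h : Exec c s s' t k) : Exec (.ite p c c') s s' (p.ops + t) k
  | iteFalse {p : Test} {c c' : Cmd} {s s' : State n} {t k : ℕ} (ok : p.Ok s) (hp : ¬ p.Holds s)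
      (h : Exec c' s s' t k) : Exec (.ite p c c') s s' (p.ops + t) k
  | loopDone {p : Test} {c : Cmd} {s : State n} (ok : p.Ok s) (hp : ¬ p.Holds s) :
      Exec (.loop p c) s s p.ops 0
  | loopStep {p : Test} {c : Cmd} {s s' s'' : State n} {t t' k k' : ℕ} (ok : p.Ok s)
      (hp : p.Holds s) (h : Exec c s s' t k) (h' : Exec (.loop p c) s' s'' t' k') :
      Exec (.loop p c) s s'' (p.ops + t + t') (k + k')

/-! ## The algorithm -/

/-- The available root-finding methods. -/
inductive Solver where
  | bisection | newton | newtonSqr | halley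

open Reg Cmd in
/-- Evaluation of `Ψ`, `Ψ'`, `Ψ''`, `Ψ̃`, `Ψ̃'` at the number in register `alpha`, together with the
sums over the entries greater than `alpha`, and the check for a sign change between the neighbouring
entries `xj ≤ alpha < xk`.  The registers `xk`, `dxk` stand for `∞` as long as no entry greater than
`alpha` has been met, that is, until `d = 1` for the first time. Every call passes one `probe`. -/
def auxCmd : Cmd := block [
  .probe,
  .assign l1 0, .assign l2sq 0, .assign d 0, .assign xj 0, .assign dxj (0 - alpha),
  forCells (block [
    .assign t (.cell - alpha),
    .ite (.lt 0 t)
      (block [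
        .assign l1 (l1 + .cell), .assign l2sq (l2sq + .cell * .cell), .assign d (d + 1),
        .ite (.or (.eq d 1) (.lt t dxk))
          (block [.assign xk .cell, .assign dxk t])
          .skip])
      (.ite (.lt dxj t)
        (block [.assign xj .cell, .assign dxj t])
        .skip)]),
  .assign l1a (l1 - d * alpha),
  .assign l2asq (l2sq - 2 * alpha * l1 + d * alpha * alpha),
  .assign psi (l1a / .sqrt l2asq - lam1 / lam2),
  .assign dpsi (1 / .sqrt l2asq * (l1a * l1a / l2asq - d)),
  .assign ddpsi (3 * dpsi * l1a / l2asq),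
  .assign psit (l1a * l1a / l2asq - lam1 * lam1 / (lam2 * lam2)),
  .assign dpsit (2 * (l1a / .sqrt l2asq) * dpsi),
  .ite (.and
      (.le (lam1 * .sqrt (l2sq - 2 * xj * l1 + d * xj * xj)) (lam2 * (l1 - d * xj)))
      (.lt (lam2 * (l1 - d * xk)) (lam1 * .sqrt (l2sq - 2 * xk * l1 + d * xk * xk))))
    (.assign finished 1)
    (.assign finished 0)]

open Reg Cmd in
/-- Put `alpha` into the middle of the current interval. -/
def midpointCmd : Cmd := .assign alpha (lo + 1 / 2 * (up - lo))

open Reg Cmd in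
/-- One iteration of root-finding, safeguarded with bisection for the methods that use
derivatives. -/
def stepCmd : Solver → Cmd
  | .bisection => midpointCmd
  | .newton => block [
      .assign alpha (alpha - psi / dpsi),
      .ite (.or (.lt alpha lo) (.lt up alpha)) midpointCmd .skip]
  | .newtonSqr => block [
      .assign alpha (alpha - psit / dpsit),
      .ite (.or (.lt alpha lo) (.lt up alpha)) midpointCmd .skip]
  | .halley => block [
      .assign h (1 - psi * ddpsi / (2 * dpsi * dpsi)),
      .assign h (.max (1 / 2) (.min (3 / 2) h)),
      .assign alpha (alpha - psi / (h * dpsi)),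
      .ite (.or (.lt alpha lo) (.lt up alpha)) midpointCmd .skip]

open Reg Cmd in
/-- The search for the interval between neighbouring entries that contains the zero of `Ψ`.
The initial upper bound is the second largest value among the entries. -/
def searchCmd (solver : Solver) : Cmd := block [
  .assign lo 0,
  .assign xmax 0,
  forCells (.ite (.lt xmax .cell) (.assign xmax .cell) .skip),
  .assign up 0,
  forCells (.ite (.and (.not (.eq .cell xmax)) (.lt up .cell)) (.assign up .cell) .skip),
  midpointCmd,
  auxCmd,
  .loop (.eq finished 0) (block [
    .ite (.lt 0 psi) (.assign lo alpha) (.assign up alpha),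
    stepCmd solver,
    auxCmd])]

open Reg Cmd in
/-- The projection algorithm.  It expects the numbers `λ₁`, `λ₂` in the registers `lam1`, `lam2`
and the vector in the array, where it also leaves the result. -/
def projCmd (solver : Solver) : Cmd := block [
  .assign alpha 0,
  auxCmd,
  .ite (.le psi 0)
    (.assign d .len)
    (searchCmd solver),
  .assign alpha
    (1 / d * (l1 - lam1 * .sqrt ((d * l2sq - l1 * l1) / (d * lam2 * lam2 - lam1 * lam1)))),
  .assign rho 0,
  forCells (block [
    .assign t (.cell - alpha),
    .ite (.lt 0 t)
      (block [.store t, .assign rho (rho + t * t)])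
      (.store 0)]),
  forCells (.store (lam2 / .sqrt rho * .cell))]

/-! ## Determinism and frame properties of the machine -/

/-! All points of `D` have the same norm, so projecting `x` onto `D` means maximising the inner
product with `x`. Suppose that for some `α` the vector `max (x - α) 0` has norms `lam1 * T` and
`lam2 * T` with the same `T > 0`. Then rescaling it by `1 / T` gives a point of `D`, and
Cauchy-Schwarz shows that no point of `D` has a larger inner product with `x`
(`mem_projSet_of_threshold`). Uniqueness of the projection identifies it with `p`, so correctness
only needs one `α` of this kind.

For a fixed active set with data `d`, `l1`, `l2`, the condition on the two norms is a quadratic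
equation for `α`, and `threshold` is its relevant root. What remains is that the guessed active set
is the set of entries above the root. The quantity `d * Q(c) - (l1 - d * c) ^ 2`, with `Q(c)` the
sum of the squared active entries after subtracting `c`, does not depend on `c`. Hence the sign
tests at `xj` and `xk` are comparisons of `xj` and `xk` with the root (`threshold_compare`), and a
successful check puts the root into `[xj, xk)` (`isGoodThreshold_of_tests`). If `Ψ(0) ≤ 0`, the root
for the full active set is at most `0`, so all entries stay active. None of this depends on how `α`
was found. For the search it suffices that the safeguard keeps `α` between `lo` and `up`, where the
evaluation of `Ψ` cannot block.

Bisection halts because `Ψ` is decreasing, strictly so as long as two different active values remain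
(`auxPsi_compare_aux`). At the second largest value only the equal maximal entries survive, so the
ratio of norms is the square root of their multiplicity. Uniqueness of `p` together with the
non-degeneracy assumption makes `Ψ` negative there, and a bracket `[a, b)` exists. The search
interval always contains the bracket and is halved in each pass, so its length `u / 2 ^ j` cannot
drop below `b - a`.

The machine is deterministic, so one explicitly constructed run speaks for all runs. Costs are
bounded compositionally from the syntax: each evaluation of `Ψ` passes one probe, and everything
between two probes costs `O(n)`. -/

theorem Exec.deterministic {n : ℕ} {c : Cmd} {s s₁ : State n} {t₁ k₁ : ℕ}
    (h₁ : Exec c s s₁ t₁ k₁) :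
    ∀ {s₂ : State n} {t₂ k₂ : ℕ}, Exec c s s₂ t₂ k₂ → s₁ = s₂ ∧ t₁ = t₂ ∧ k₁ = k₂ := by
  induction h₁ with
  | skip s => intro _ _ _ h; cases h; simp
  | probe s => intro _ _ _ h; cases h; simp
  | assign s r e ok => intro _ _ _ h; cases h; simp
  | store s e ok hi => intro _ _ _ h; cases h; simp
  | rewind s => intro _ _ _ h; cases h; simp
  | advance s => intro _ _ _ h; cases h; simp
  | seq h h' ih ih' =>
    intro _ _ _ g
    cases g with
    | seq g g' =>
      obtain ⟨rfl, rfl, rfl⟩ := ih g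
      obtain ⟨rfl, rfl, rfl⟩ := ih' g'
      simp
  | iteTrue ok hp h ih =>
    intro _ _ _ g
    cases g with
    | iteTrue _ _ g => obtain ⟨rfl, rfl, rfl⟩ := ih g; simp
    | iteFalse _ hq _ => exact absurd hp hq
  | iteFalse ok hp h ih =>
    intro _ _ _ g
    cases g with
    | iteTrue _ hq _ => exact absurd hq hp
    | iteFalse _ _ g => obtain ⟨rfl, rfl, rfl⟩ := ih g; simp
  | loopDone ok hp =>
    intro _ _ _ g
    cases g with
    | loopDone => simp
    | loopStep _ hq _ _ => exact absurd hq hp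
  | loopStep ok hp h h' ih ih' =>
    intro _ _ _ g
    cases g with
    | loopDone _ hq => exact absurd hp hq
    | loopStep _ _ g g' =>
      obtain ⟨rfl, rfl, rfl⟩ := ih g
      obtain ⟨rfl, rfl, rfl⟩ := ih' g'
      simp

/-- No assignment in the program writes to register `r`. -/
def Cmd.keeps (r : Reg) : Cmd → Bool
  | .assign r' _ => !decide (r = r')
  | .seq c c' => keeps r c && keeps r c'
  | .ite _ c c' => keeps r c && keeps r c'
  | .loop _ c => keeps r c
  | _ => true

/-- The program does not write to the array. -/
def Cmd.keepsArr : Cmd → Bool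
  | .store _ => false
  | .seq c c' => keepsArr c && keepsArr c'
  | .ite _ c c' => keepsArr c && keepsArr c'
  | .loop _ c => keepsArr c
  | _ => true

theorem Exec.reg_eq {n : ℕ} {c : Cmd} {s s' : State n} {t k : ℕ} (h : Exec c s s' t k) {r : Reg}
    (hr : c.keeps r = true) : s'.reg r = s.reg r := by
  induction h with
  | assign s r' e ok =>
    have : r ≠ r' := by simpa [Cmd.keeps] using hr
    simp [Function.update_of_ne this]
  | seq _ _ ih ih' =>
    simp only [Cmd.keeps, Bool.and_eq_true] at hr
    rw [ih' hr.2, ih hr.1]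
  | iteTrue _ _ _ ih => simp only [Cmd.keeps, Bool.and_eq_true] at hr; exact ih hr.1
  | iteFalse _ _ _ ih => simp only [Cmd.keeps, Bool.and_eq_true] at hr; exact ih hr.2
  | loopStep _ _ _ _ ih ih' => rw [ih' hr, ih hr]
  | _ => rfl

theorem Exec.arr_eq {n : ℕ} {c : Cmd} {s s' : State n} {t k : ℕ} (h : Exec c s s' t k)
    (hc : c.keepsArr = true) : s'.arr = s.arr := by
  induction h with
  | store => simp [Cmd.keepsArr] at hc
  | seq _ _ ih ih' =>
    simp only [Cmd.keepsArr, Bool.and_eq_true] at hc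
    rw [ih' hc.2, ih hc.1]
  | iteTrue _ _ _ ih => simp only [Cmd.keepsArr, Bool.and_eq_true] at hc; exact ih hc.1
  | iteFalse _ _ _ ih => simp only [Cmd.keepsArr, Bool.and_eq_true] at hc; exact ih hc.2
  | loopStep _ _ _ _ ih ih' => rw [ih' hc, ih hc]
  | _ => rfl

/-! ## Evaluation of the overloaded notation for expressions -/

section Notation

variable {n : ℕ} (s : State n) (a b : Expr)

theorem Expr.eval_hSub : (a - b).eval s = a.eval s - b.eval s := rfl
theorem Expr.eval_hDiv : (a / b).eval s = a.eval s / b.eval s := rfl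
theorem Expr.ok_hSub : (a - b).Ok s ↔ a.Ok s ∧ b.Ok s := Iff.rfl
theorem Expr.ok_hDiv : (a / b).Ok s ↔ a.Ok s ∧ b.Ok s ∧ b.eval s ≠ 0 := Iff.rfl

end Notation

/-! ## Total and partial correctness -/

/-- The program halts, in a state with property `P`. -/
def Runs {n : ℕ} (c : Cmd) (s : State n) (P : State n → Prop) : Prop :=
  ∃ s' t k, Exec c s s' t k ∧ P s'

/-- If the program halts, then in a state with property `P`. -/
def Always {n : ℕ} (c : Cmd) (s : State n) (P : State n → Prop) : Prop :=
  ∀ s' t k, Exec c s s' t k → P s'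

section Correctness

variable {n : ℕ} {s : State n} {P Q : State n → Prop} {c c' : Cmd}

/-- By determinism the constructed run is the only one, so total correctness implies partial
correctness. Blocks that cannot get stuck are treated with `Runs`, the possibly blocking solver
steps with `Always`. -/
theorem Runs.always (h : Runs c s P) : Always c s P := by
  obtain ⟨s₁, t₁, k₁, h₁, hP⟩ := h
  intro s' t k h'
  obtain ⟨rfl, -, -⟩ := h₁.deterministic h'
  exact hP

theorem Runs.mono (h : Runs c s P) (hPQ : ∀ s', P s' → Q s') : Runs c s Q := by
  obtain ⟨s₁, t₁, k₁, h₁, hP⟩ := h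
  exact ⟨s₁, t₁, k₁, h₁, hPQ _ hP⟩

theorem Always.mono (h : Always c s P) (hPQ : ∀ s', P s' → Q s') : Always c s Q :=
  fun s' t k h' => hPQ _ (h s' t k h')

/-- Weakest-precondition rules start here. As equivalences they let `simp` execute straight-line
code symbolically. -/
theorem runs_skip : Runs .skip s P ↔ P s := by
  constructor
  · rintro ⟨_, _, _, h, hP⟩; cases h; exact hP
  · exact fun h => ⟨_, _, _, .skip s, h⟩

theorem runs_probe : Runs .probe s P ↔ P s := by
  constructor
  · rintro ⟨_, _, _, h, hP⟩; cases h; exact hP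
  · exact fun h => ⟨_, _, _, .probe s, h⟩

theorem runs_assign {r : Reg} {e : Expr} : Runs (.assign r e) s P ↔
    e.Ok s ∧ P { s with reg := Function.update s.reg r (e.eval s) } := by
  constructor
  · rintro ⟨_, _, _, h, hP⟩
    cases h with
    | assign _ _ _ ok => exact ⟨ok, hP⟩
  · exact fun h => ⟨_, _, _, .assign s r e h.1, h.2⟩

theorem runs_store {e : Expr} : Runs (.store e) s P ↔
    e.Ok s ∧ ∃ hi : s.idx < n,
      P { s with arr := Function.update s.arr ⟨s.idx, hi⟩ (e.eval s) } := by
  constructor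
  · rintro ⟨_, _, _, h, hP⟩
    cases h with
    | store _ _ ok hi => exact ⟨ok, hi, hP⟩
  · exact fun ⟨ok, hi, h⟩ => ⟨_, _, _, .store s e ok hi, h⟩

theorem runs_seq : Runs (.seq c c') s P ↔ Runs c s fun s' => Runs c' s' P := by
  constructor
  · rintro ⟨_, _, _, h, hP⟩
    cases h with
    | seq h h' => exact ⟨_, _, _, h, _, _, _, h', hP⟩
  · rintro ⟨_, _, _, h, _, _, _, h', hP⟩
    exact ⟨_, _, _, .seq h h', hP⟩

theorem runs_ite {p : Test} : Runs (.ite p c c') s P ↔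
    p.Ok s ∧ (p.Holds s → Runs c s P) ∧ (¬ p.Holds s → Runs c' s P) := by
  constructor
  · rintro ⟨_, _, _, h, hP⟩
    cases h with
    | iteTrue ok hp h => exact ⟨ok, fun _ => ⟨_, _, _, h, hP⟩, fun hn => absurd hp hn⟩
    | iteFalse ok hp h => exact ⟨ok, fun hn => absurd hn hp, fun _ => ⟨_, _, _, h, hP⟩⟩
  · rintro ⟨ok, h, h'⟩
    by_cases hp : p.Holds s
    · obtain ⟨_, _, _, h, hP⟩ := h hp
      exact ⟨_, _, _, .iteTrue ok hp h, hP⟩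
    · obtain ⟨_, _, _, h, hP⟩ := h' hp
      exact ⟨_, _, _, .iteFalse ok hp h, hP⟩

theorem always_skip : Always .skip s P ↔ P s :=
  ⟨fun h => h _ _ _ (.skip s), fun h _ _ _ g => by cases g; exact h⟩

theorem always_assign {r : Reg} {e : Expr} : Always (.assign r e) s P ↔
    (e.Ok s → P { s with reg := Function.update s.reg r (e.eval s) }) :=
  ⟨fun h ok => h _ _ _ (.assign s r e ok), fun h _ _ _ g => by
    cases g with
    | assign _ _ _ ok => exact h ok⟩

theorem always_seq : Always (.seq c c') s P ↔ Always c s fun s' => Always c' s' P :=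
  ⟨fun h _ _ _ g _ _ _ g' => h _ _ _ (.seq g g'), fun h _ _ _ g => by
    cases g with
    | seq g g' => exact h _ _ _ g _ _ _ g'⟩

theorem always_ite {p : Test} : Always (.ite p c c') s P ↔
    (p.Ok s → (p.Holds s → Always c s P) ∧ (¬ p.Holds s → Always c' s P)) :=
  ⟨fun h ok => ⟨fun hp _ _ _ g => h _ _ _ (.iteTrue ok hp g),
      fun hp _ _ _ g => h _ _ _ (.iteFalse ok hp g)⟩,
    fun h _ _ _ g => by
      cases g with
      | iteTrue ok hp g => exact (h ok).1 hp _ _ _ g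
      | iteFalse ok hp g => exact (h ok).2 hp _ _ _ g⟩

theorem Always.loop {p : Test} (hP : P s) (hc : ∀ s, P s → p.Holds s → Always c s P) :
    Always (.loop p c) s fun s' => P s' ∧ ¬ p.Holds s' := by
  -- The program becomes a variable with an equation, since induction on `Exec` needs a free index.
  suffices H : ∀ (d : Cmd) (s s' : State n) (t k : ℕ), Exec d s s' t k → d = .loop p c → P s →
      P s' ∧ ¬ p.Holds s' from fun s' t k g => H _ s s' t k g rfl hP
  intro d s s' t k g
  induction g with
  | loopDone ok hp => intro hd hs; cases hd; exact ⟨hs, hp⟩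
  | loopStep ok hp h h' ih ih' =>
    intro hd hs
    cases hd
    exact ih' rfl (hc _ hs hp _ _ _ h)
  | _ => intro hd; cases hd

/-- A scan through the array, with an invariant `I j` after the first `j` entries. -/
theorem Runs.forCells (I : ℕ → (Reg → ℝ) → (Fin n → ℝ) → Prop) (h0 : I 0 s.reg s.arr)
    (step : ∀ j (_ : j < n) (s : State n), s.idx = j → I j s.reg s.arr →
      Runs c s fun s' => s'.idx = j ∧ I (j + 1) s'.reg s'.arr) :
    Runs (.forCells c) s fun s' => I n s'.reg s'.arr := by
  rw [Cmd.forCells, runs_seq]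
  refine ⟨_, _, _, .rewind s, ?_⟩
  -- Induction on the number `r` of entries still to be visited.
  suffices H : ∀ (r j : ℕ) (s : State n), j + r = n → s.idx = j → I j s.reg s.arr →
      Runs (.loop .inRange (.seq c .advance)) s fun s' => I n s'.reg s'.arr from
    H n 0 _ (by simp) rfl h0
  intro r
  induction r with
  | zero =>
    intro j s hj hs hI
    obtain rfl : j = n := by simpa using hj
    refine ⟨s, _, _, .loopDone trivial ?_, hI⟩
    simp [Test.Holds, hs]
  | succ r ih =>
    intro j s hj hs hI
    obtain ⟨s₁, t₁, k₁, h₁, hi, hI₁⟩ := step j (by omega) s hs hI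
    obtain ⟨s₂, t₂, k₂, h₂, hI₂⟩ := ih (j + 1) { s₁ with idx := s₁.idx + 1 } (by omega)
      (by simp [hi]) hI₁
    refine ⟨s₂, _, _, .loopStep trivial ?_ (.seq h₁ (.advance s₁)) h₂, hI₂⟩
    simp only [Test.Holds]
    omega

end Correctness

/-! ## Running times -/

/-- Every run takes a bounded number of operations, passes no probe and restores the pointer. -/
def ConstCost (c : Cmd) : Prop :=
  ∃ A : ℕ, ∀ (n : ℕ) (s s' : State n) (t k : ℕ), Exec c s s' t k → t ≤ A ∧ k = 0 ∧ s'.idx = s.idx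

/-- Every run takes `O(n)` operations and passes `m` probes. -/
def LinCost (c : Cmd) (m : ℕ) : Prop :=
  ∃ A : ℕ, ∀ (n : ℕ) (s s' : State n) (t k : ℕ), 0 < n → Exec c s s' t k → t ≤ A * n ∧ k = m

theorem ConstCost.skip : ConstCost .skip := ⟨0, fun _ _ _ _ _ h => by cases h; simp⟩

theorem ConstCost.assign (r : Reg) (e : Expr) : ConstCost (.assign r e) :=
  ⟨e.ops + 1, fun _ _ _ _ _ h => by cases h; simp⟩

theorem ConstCost.store (e : Expr) : ConstCost (.store e) :=
  ⟨e.ops + 1, fun _ _ _ _ _ h => by cases h; simp⟩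

theorem ConstCost.seq {c c' : Cmd} (hc : ConstCost c) (hc' : ConstCost c') :
    ConstCost (.seq c c') := by
  obtain ⟨A, hA⟩ := hc
  obtain ⟨B, hB⟩ := hc'
  refine ⟨A + B, fun n s s' t k h => ?_⟩
  cases h with
  | seq h h' =>
    obtain ⟨h₁, h₂, h₃⟩ := hA _ _ _ _ _ h
    obtain ⟨g₁, g₂, g₃⟩ := hB _ _ _ _ _ h'
    exact ⟨by omega, by omega, by omega⟩

theorem ConstCost.ite {p : Test} {c c' : Cmd} (hc : ConstCost c) (hc' : ConstCost c') :
    ConstCost (.ite p c c') := by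
  obtain ⟨A, hA⟩ := hc
  obtain ⟨B, hB⟩ := hc'
  refine ⟨p.ops + A + B, fun n s s' t k h => ?_⟩
  cases h with
  | iteTrue _ _ h => obtain ⟨h₁, h₂, h₃⟩ := hA _ _ _ _ _ h; exact ⟨by omega, h₂, h₃⟩
  | iteFalse _ _ h => obtain ⟨h₁, h₂, h₃⟩ := hB _ _ _ _ _ h; exact ⟨by omega, h₂, h₃⟩

theorem ConstCost.linCost {c : Cmd} (hc : ConstCost c) : LinCost c 0 := by
  obtain ⟨A, hA⟩ := hc
  refine ⟨A, fun n s s' t k hn h => ?_⟩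
  obtain ⟨h₁, h₂, -⟩ := hA _ _ _ _ _ h
  exact ⟨h₁.trans (Nat.le_mul_of_pos_right _ hn), h₂⟩

theorem LinCost.probe : LinCost .probe 1 := ⟨0, fun _ _ _ _ _ _ h => by cases h; simp⟩

theorem LinCost.seq {c c' : Cmd} {m m' : ℕ} (hc : LinCost c m) (hc' : LinCost c' m') :
    LinCost (.seq c c') (m + m') := by
  obtain ⟨A, hA⟩ := hc
  obtain ⟨B, hB⟩ := hc'
  refine ⟨A + B, fun n s s' t k hn h => ?_⟩
  cases h with
  | seq h h' =>
    obtain ⟨h₁, h₂⟩ := hA _ _ _ _ _ hn h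
    obtain ⟨g₁, g₂⟩ := hB _ _ _ _ _ hn h'
    exact ⟨by rw [add_mul]; omega, by omega⟩

/-- The body restores the pointer, so `n - s.idx` drops by exactly one per pass. A pass costs at
most `A + 2` including test and advance; the rewind and the final test add `2`, which `0 < n`
absorbs into `A + 4`. -/
theorem LinCost.forCells {c : Cmd} (hc : ConstCost c) : LinCost (.forCells c) 0 := by
  obtain ⟨A, hA⟩ := hc
  suffices H : ∀ (n : ℕ) (d : Cmd) (s s' : State n) (t k : ℕ), Exec d s s' t k →
      d = .loop .inRange (.seq c .advance) → t ≤ 1 + (A + 2) * (n - s.idx) ∧ k = 0 by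
    refine ⟨A + 4, fun n s s' t k hn h => ?_⟩
    cases h with
    | seq h h' =>
      cases h
      obtain ⟨h₁, h₂⟩ := H _ _ _ _ _ _ h' rfl
      simp only [Nat.sub_zero] at h₁
      exact ⟨by nlinarith, by omega⟩
  intro n d s s' t k h
  induction h with
  | loopDone ok hp => intro hd; cases hd; simp [Test.ops]
  | @loopStep p _ s s' s'' _ _ _ _ ok hp h h' ih ih' =>
    intro hd
    cases hd
    obtain ⟨h₁, h₂⟩ := ih' rfl
    cases h with
    | seq h g =>
      cases g
      obtain ⟨g₁, g₂, g₃⟩ := hA _ _ _ _ _ h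
      simp only [Test.Holds] at hp
      obtain ⟨r, hr⟩ : ∃ r, n - s.idx = r + 1 := ⟨n - s.idx - 1, by omega⟩
      simp only [g₃, show n - (s.idx + 1) = r by omega] at h₁
      rw [hr]
      simp only [Test.ops]
      exact ⟨by nlinarith, by omega⟩
  | _ => intro hd; cases hd

/-! ## Projections onto the target set -/

section Projection

variable {n : ℕ} {lam1 lam2 : ℝ} {x p : EuclideanSpace ℝ (Fin n)}

theorem mem_sparseSet_iff (h2 : 0 < lam2) {y : EuclideanSpace ℝ (Fin n)} :
    y ∈ sparseSet n lam1 lam2 ↔ (∀ i, 0 ≤ y i) ∧ ∑ i, y i = lam1 ∧ ∑ i, y i ^ 2 = lam2 ^ 2 := by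
  have key : ‖y‖ = lam2 ↔ ∑ i, y i ^ 2 = lam2 ^ 2 := by
    rw [← EuclideanSpace.real_norm_sq_eq]
    exact (pow_left_inj₀ (norm_nonneg _) h2.le two_ne_zero).symm
  simp only [sparseSet, Set.mem_ofPred_eq, key]
  refine and_congr_right fun hy => ?_
  simp [abs_of_nonneg (hy _)]

/-- In the expansion of the squared distance only the inner product with `x` varies over the target
set. -/
theorem norm_sub_le_norm_sub_iff (h2 : 0 < lam2) {y z : EuclideanSpace ℝ (Fin n)}
    (hy : y ∈ sparseSet n lam1 lam2) (hz : z ∈ sparseSet n lam1 lam2) :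
    ‖y - x‖ ≤ ‖z - x‖ ↔ ∑ i, x i * z i ≤ ∑ i, x i * y i := by
  rw [mem_sparseSet_iff h2] at hy hz
  rw [← sq_le_sq₀ (norm_nonneg _) (norm_nonneg _), EuclideanSpace.real_norm_sq_eq,
    EuclideanSpace.real_norm_sq_eq]
  have key : ∀ w : EuclideanSpace ℝ (Fin n), ∑ i, (w - x) i ^ 2 =
      ∑ i, w i ^ 2 - 2 * ∑ i, x i * w i + ∑ i, x i ^ 2 := by
    intro w
    rw [Finset.mul_sum, ← Finset.sum_sub_distrib, ← Finset.sum_add_distrib]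
    exact Finset.sum_congr rfl fun i _ => by simp; ring
  rw [key, key, hy.2.2, hz.2.2]
  constructor <;> intro h <;> linarith

/-- From `x i ≤ max (x i - α) 0 + α` and `0 ≤ y i` one gets `⟨x, y⟩ ≤ T * ⟨z, y⟩ + α * lam1`, with
equality for `y = z`. Cauchy-Schwarz bounds `⟨z, y⟩` by `lam2 ^ 2 = ⟨z, z⟩`. -/
theorem mem_projSet_of_threshold (h2 : 0 < lam2) {α T : ℝ} (hT : 0 < T)
    (hs1 : ∑ i, max (x i - α) 0 = lam1 * T) (hs2 : ∑ i, max (x i - α) 0 ^ 2 = lam2 ^ 2 * T ^ 2)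
    {z : EuclideanSpace ℝ (Fin n)} (hz : ∀ i, z i = max (x i - α) 0 / T) :
    z ∈ projSet (sparseSet n lam1 lam2) x := by
  have hzm : z ∈ sparseSet n lam1 lam2 := by
    rw [mem_sparseSet_iff h2]
    refine ⟨fun i => by rw [hz]; positivity, ?_, ?_⟩
    · simp only [hz, ← Finset.sum_div, hs1]; field_simp
    · simp only [hz, div_pow, ← Finset.sum_div, hs2]; field_simp
  refine ⟨hzm, fun y hy => ?_⟩
  rw [norm_sub_le_norm_sub_iff h2 hzm hy]
  rw [mem_sparseSet_iff h2] at hzm hy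
  have hxz : ∑ i, x i * z i = T * lam2 ^ 2 + α * lam1 := by
    rw [← hzm.2.2, ← hzm.2.1, Finset.mul_sum, Finset.mul_sum, ← Finset.sum_add_distrib]
    refine Finset.sum_congr rfl fun i _ => ?_
    rw [hz]
    rcases le_total (x i - α) 0 with h | h
    · simp [max_eq_right h]
    · rw [max_eq_left h]; field_simp; ring
  have hxy : ∑ i, x i * y i ≤ T * ∑ i, z i * y i + α * lam1 := by
    rw [← hy.2.1, Finset.mul_sum, Finset.mul_sum, ← Finset.sum_add_distrib]
    refine Finset.sum_le_sum fun i _ => ?_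
    have h1 : T * (z i * y i) = max (x i - α) 0 * y i := by rw [hz]; field_simp
    rw [h1]
    nlinarith [hy.1 i, le_max_left (x i - α) 0]
  have hcs : ∑ i, z i * y i ≤ lam2 ^ 2 := by
    have := Finset.sum_mul_sq_le_sq_mul_sq Finset.univ (fun i => z i) (fun i => y i)
    rw [hzm.2.2, hy.2.2] at this
    nlinarith [sq_nonneg (∑ i, z i * y i + lam2 ^ 2), sq_nonneg lam2]
  nlinarith

/-- If `p i > p j`, exchanging these two coordinates stays in the target set and changes the inner
product with `x` by `(x j - x i) * (p i - p j) ≥ 0`. This would be a second projection. Uniqueness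
is what covers the case `x i = x j`. -/
theorem mono_of_projSet_eq_singleton (h2 : 0 < lam2)
    (hp : projSet (sparseSet n lam1 lam2) x = {p}) {i j : Fin n} (hij : x i ≤ x j) :
    p i ≤ p j := by
  by_contra! hlt
  have hpm : p ∈ projSet (sparseSet n lam1 lam2) x := by rw [hp]; rfl
  set q : EuclideanSpace ℝ (Fin n) := WithLp.toLp 2 fun l => p (Equiv.swap i j l) with hq
  have hqm : q ∈ sparseSet n lam1 lam2 := by
    have := hpm.1
    rw [mem_sparseSet_iff h2] at this ⊢
    refine ⟨fun l => this.1 _, ?_, ?_⟩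
    · rw [← this.2.1]; exact Equiv.sum_comp (Equiv.swap i j) fun l => p l
    · rw [← this.2.2]; exact Equiv.sum_comp (Equiv.swap i j) fun l => p l ^ 2
  have hne : i ≠ j := by rintro rfl; exact lt_irrefl _ hlt
  have hle : ∑ l, x l * p l ≤ ∑ l, x l * q l := by
    rw [← sub_nonneg, ← Finset.sum_sub_distrib]
    rw [← Finset.sum_subset (Finset.subset_univ {i, j}), Finset.sum_pair hne]
    · simp only [hq, Equiv.swap_apply_left, Equiv.swap_apply_right]
      nlinarith
    · intro l _ hl
      simp only [Finset.mem_insert, Finset.mem_singleton, not_or] at hl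
      simp [hq, Equiv.swap_apply_of_ne_of_ne hl.1 hl.2]
  have : q ∈ projSet (sparseSet n lam1 lam2) x := by
    refine ⟨hqm, fun z hz => le_trans ?_ (hpm.2 z hz)⟩
    rwa [norm_sub_le_norm_sub_iff h2 hqm hpm.1]
  rw [hp] at this
  have h : q j = p j := by rw [Set.mem_singleton_iff.mp this]
  simp only [hq, Equiv.swap_apply_right] at h
  exact hlt.ne' h

theorem mem_sparseSet_of_projSet_eq_singleton
    (hp : projSet (sparseSet n lam1 lam2) x = {p}) : p ∈ sparseSet n lam1 lam2 := by
  have : p ∈ projSet (sparseSet n lam1 lam2) x := by rw [hp]; rfl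
  exact this.1

/-- A constant `x` would force a constant `p`, whose norms have ratio exactly `√n`. -/
theorem exists_lt_of_projSet_eq_singleton (h2 : 0 < lam2) (h21 : lam2 < lam1)
    (h1n : lam1 < Real.sqrt n * lam2) (hp : projSet (sparseSet n lam1 lam2) x = {p}) :
    ∃ i j, x i < x j := by
  by_contra! h
  have hpm := (mem_sparseSet_iff h2).mp (mem_sparseSet_of_projSet_eq_singleton hp)
  have hn : 0 < n := by
    rcases Nat.eq_zero_or_pos n with rfl | hn
    · simp at h1n; linarith
    · exact hn
  have hc : ∀ i, p i = p ⟨0, hn⟩ := fun i =>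
    le_antisymm (mono_of_projSet_eq_singleton h2 hp (h _ _))
      (mono_of_projSet_eq_singleton h2 hp (h _ _))
  simp only [hc, Finset.sum_const, Finset.card_univ, Fintype.card_fin, nsmul_eq_mul] at hpm
  obtain ⟨-, e1, e2⟩ := hpm
  have h3 : lam1 ^ 2 < (Real.sqrt n * lam2) ^ 2 := by gcongr; linarith
  rw [mul_pow, Real.sq_sqrt (Nat.cast_nonneg n), ← e1, ← e2] at h3
  exact absurd h3 (by apply le_of_eq _ |>.not_gt; ring)

/-- By monotonicity `p` attains its maximum `M` at all maximal positions of `x`. With `m` such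
positions, `m * M ≤ lam1` and `lam2 ^ 2 ≤ M * lam1`; combine the two. -/
theorem maxMult_mul_sq_le (h2 : 0 < lam2) (h21 : lam2 < lam1)
    (hp : projSet (sparseSet n lam1 lam2) x = {p}) :
    (maxMult x : ℝ) * lam2 ^ 2 ≤ lam1 ^ 2 := by
  classical
  obtain ⟨h0, e1, e2⟩ := (mem_sparseSet_iff h2).mp (mem_sparseSet_of_projSet_eq_singleton hp)
  have hmul : maxMult x = (Finset.univ.filter fun i => ∀ j, x j ≤ x i).card := by
    rw [maxMult, ← Set.ncard_coe_finset]; simp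
  rcases isEmpty_or_nonempty (Fin n) with he | hne
  · simp at e1; linarith
  obtain ⟨i₀, hi₀⟩ := Finite.exists_max fun i => x i
  have hle : ∀ i, p i ≤ p i₀ := fun i => mono_of_projSet_eq_singleton h2 hp (hi₀ i)
  have hs2 : lam2 ^ 2 ≤ p i₀ * lam1 := by
    rw [← e2, ← e1, Finset.mul_sum]
    exact Finset.sum_le_sum fun i _ => by nlinarith [h0 i, hle i]
  have hs1 : (maxMult x : ℝ) * p i₀ ≤ lam1 := by
    rw [← e1, hmul, ← nsmul_eq_mul]
    refine (Finset.card_nsmul_le_sum _ _ _ fun i hi => ?_).trans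
      (Finset.sum_le_sum_of_subset_of_nonneg (Finset.subset_univ _) fun i _ _ => h0 i)
    exact mono_of_projSet_eq_singleton h2 hp ((Finset.mem_filter.mp hi).2 i₀)
  calc (maxMult x : ℝ) * lam2 ^ 2 ≤ maxMult x * (p i₀ * lam1) := by gcongr
    _ = (maxMult x * p i₀) * lam1 := by ring
    _ ≤ lam1 * lam1 := by gcongr; linarith
    _ = lam1 ^ 2 := by ring

end Projection

/-! ## The threshold belonging to an active set -/

/-- The number that has to be subtracted from the active entries, where `d` is the number of active
entries, `l1` their sum and `l2` the sum of their squares. -/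
noncomputable def threshold (lam1 lam2 d l1 l2 : ℝ) : ℝ :=
  1 / d * (l1 - lam1 * Real.sqrt ((d * l2 - l1 * l1) / (d * lam2 * lam2 - lam1 * lam1)))

section Threshold

variable {lam1 lam2 d l1 l2 : ℝ}

/-- The square root in `threshold` is the common scale `T` of both norms. The second norm identity
is checked after multiplication by `d`, where it follows from the first one and the defining
equation of `T ^ 2`. -/
theorem exists_scale (hd : 0 < d) (hv : 0 < d * l2 - l1 * l1)
    (hw : 0 < d * lam2 * lam2 - lam1 * lam1) :
    ∃ T, 0 < T ∧ l1 - d * threshold lam1 lam2 d l1 l2 = lam1 * T ∧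
      l2 - 2 * threshold lam1 lam2 d l1 l2 * l1 +
        d * threshold lam1 lam2 d l1 l2 * threshold lam1 lam2 d l1 l2 = lam2 ^ 2 * T ^ 2 ∧
      T ^ 2 * (d * lam2 * lam2 - lam1 * lam1) = d * l2 - l1 * l1 := by
  set T := Real.sqrt ((d * l2 - l1 * l1) / (d * lam2 * lam2 - lam1 * lam1)) with hT
  have hT2 : T ^ 2 * (d * lam2 * lam2 - lam1 * lam1) = d * l2 - l1 * l1 := by
    rw [hT, Real.sq_sqrt (by positivity), div_mul_cancel₀ _ hw.ne']
  have e1 : l1 - d * threshold lam1 lam2 d l1 l2 = lam1 * T := by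
    rw [threshold, ← hT]; field_simp; ring
  refine ⟨T, Real.sqrt_pos.mpr (by positivity), e1, ?_, hT2⟩
  set α := threshold lam1 lam2 d l1 l2
  have : d * (l2 - 2 * α * l1 + d * α * α) = d * (lam2 ^ 2 * T ^ 2) := by
    linear_combination (l1 - d * α + lam1 * T) * e1 - hT2
  exact mul_left_cancel₀ hd.ne' this

/-- Squared and multiplied by `d`, the difference of the two sides is `(l1 - d * c) ^ 2 - (l1 - d *
α) ^ 2` times a positive constant, where `α` is the threshold. Both bases are non-negative, so its
sign is that of `α - c`. -/
theorem threshold_compare (h1 : 0 < lam1) (h2 : 0 < lam2) (hd : 0 < d)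
    (hv : 0 < d * l2 - l1 * l1) (hw : 0 < d * lam2 * lam2 - lam1 * lam1) {c : ℝ}
    (hc : 0 ≤ l1 - d * c) :
    (lam1 * Real.sqrt (l2 - 2 * c * l1 + d * c * c) ≤ lam2 * (l1 - d * c) ↔
      c ≤ threshold lam1 lam2 d l1 l2) ∧
    (lam2 * (l1 - d * c) ≤ lam1 * Real.sqrt (l2 - 2 * c * l1 + d * c * c) ↔
      threshold lam1 lam2 d l1 l2 ≤ c) := by
  obtain ⟨T, hT, e1, -, hT2⟩ := exists_scale hd hv hw
  set α := threshold lam1 lam2 d l1 l2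
  have hQ : 0 ≤ l2 - 2 * c * l1 + d * c * c := by
    have : 0 ≤ d * (l2 - 2 * c * l1 + d * c * c) := by nlinarith [sq_nonneg (l1 - d * c)]
    exact nonneg_of_mul_nonneg_right this hd
  have key : d * ((lam2 * (l1 - d * c)) ^ 2 -
      (lam1 * Real.sqrt (l2 - 2 * c * l1 + d * c * c)) ^ 2) =
      ((l1 - d * c) ^ 2 - (l1 - d * α) ^ 2) * (d * lam2 * lam2 - lam1 * lam1) := by
    rw [e1, mul_pow lam1 (√_), Real.sq_sqrt hQ]
    linear_combination lam1 ^ 2 * hT2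
  have hα : 0 ≤ l1 - d * α := by rw [e1]; positivity
  constructor
  · rw [← sq_le_sq₀ (by positivity) (by positivity), ← sub_nonneg, ← mul_nonneg_iff_of_pos_left hd,
      key, mul_nonneg_iff_of_pos_right hw, sub_nonneg, sq_le_sq₀ hα hc, sub_le_sub_iff_left,
      mul_le_mul_iff_right₀ hd]
  · rw [← sq_le_sq₀ (by positivity) (by positivity), ← sub_nonpos, ← neg_nonneg,
      ← mul_nonneg_iff_of_pos_left hd, mul_neg, key, ← neg_mul, mul_nonneg_iff_of_pos_right hw,
      neg_sub, sub_nonneg, sq_le_sq₀ hc hα, sub_le_sub_iff_left, mul_le_mul_iff_right₀ hd]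

end Threshold

/-! ## Sums over the active entries -/

/-- The number of entries greater than `α`. -/
noncomputable def actCard {n : ℕ} (x : EuclideanSpace ℝ (Fin n)) (α : ℝ) : ℝ :=
  ∑ i, if α < x i then 1 else 0

/-- The sum of the entries greater than `α`. -/
noncomputable def actSum {n : ℕ} (x : EuclideanSpace ℝ (Fin n)) (α : ℝ) : ℝ :=
  ∑ i, if α < x i then x i else 0

/-- The sum of the squares of the entries greater than `α`. -/
noncomputable def actSq {n : ℕ} (x : EuclideanSpace ℝ (Fin n)) (α : ℝ) : ℝ :=
  ∑ i, if α < x i then x i * x i else 0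

section Active

variable {n : ℕ} {x : EuclideanSpace ℝ (Fin n)} {α c : ℝ}

theorem actSum_sub : actSum x α - actCard x α * c = ∑ i, if α < x i then x i - c else 0 := by
  rw [actSum, actCard, Finset.sum_mul, ← Finset.sum_sub_distrib]
  exact Finset.sum_congr rfl fun i _ => by split_ifs <;> ring

theorem actSq_sub : actSq x α - 2 * c * actSum x α + actCard x α * c * c =
    ∑ i, if α < x i then (x i - c) ^ 2 else 0 := by
  rw [actSum, actCard, actSq, mul_assoc (∑ i, _), Finset.sum_mul, Finset.mul_sum,
    ← Finset.sum_sub_distrib, ← Finset.sum_add_distrib]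
  exact Finset.sum_congr rfl fun i _ => by split_ifs <;> ring

theorem actSq_sub_nonneg : 0 ≤ actSq x α - 2 * c * actSum x α + actCard x α * c * c := by
  rw [actSq_sub]
  exact Finset.sum_nonneg fun i _ => by split_ifs <;> positivity

/-- If `c` separates the active entries from the others, the sums describe `max (x - c) 0`. -/
theorem actSum_sub_eq (h1 : ∀ i, α < x i → c ≤ x i) (h2 : ∀ i, x i ≤ α → x i ≤ c) :
    actSum x α - actCard x α * c = ∑ i, max (x i - c) 0 := by
  rw [actSum_sub]
  refine Finset.sum_congr rfl fun i _ => ?_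
  split_ifs with h
  · rw [max_eq_left (by linarith [h1 i h])]
  · rw [max_eq_right (by linarith [h2 i (not_lt.mp h)])]

theorem actSq_sub_eq (h1 : ∀ i, α < x i → c ≤ x i) (h2 : ∀ i, x i ≤ α → x i ≤ c) :
    actSq x α - 2 * c * actSum x α + actCard x α * c * c = ∑ i, max (x i - c) 0 ^ 2 := by
  rw [actSq_sub]
  refine Finset.sum_congr rfl fun i _ => ?_
  split_ifs with h
  · rw [max_eq_left (by linarith [h1 i h])]
  · rw [max_eq_right (by linarith [h2 i (not_lt.mp h)])]; simp

theorem actCard_pos (h : ∃ i, α < x i) : 0 < actCard x α := by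
  obtain ⟨i, hi⟩ := h
  refine Finset.sum_pos' (fun i _ => by split_ifs <;> norm_num) ⟨i, Finset.mem_univ _, ?_⟩
  simp [hi]

theorem actSum_sub_pos (h : ∃ i, α < x i) (hc : ∀ i, α < x i → c < x i) :
    0 < actSum x α - actCard x α * c := by
  rw [actSum_sub]
  obtain ⟨i, hi⟩ := h
  refine Finset.sum_pos' (fun i _ => ?_) ⟨i, Finset.mem_univ _, ?_⟩
  · split_ifs with h
    · linarith [hc i h]
    · rfl
  · rw [if_pos hi]; linarith [hc i hi]

theorem sum_max_pos (h : ∃ i, α < x i) : 0 < ∑ i, max (x i - α) 0 := by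
  obtain ⟨i, hi⟩ := h
  exact Finset.sum_pos' (fun i _ => le_max_right _ _)
    ⟨i, Finset.mem_univ _, lt_max_of_lt_left (by linarith)⟩

theorem sum_max_sq_pos (h : ∃ i, α < x i) : 0 < ∑ i, max (x i - α) 0 ^ 2 := by
  obtain ⟨i, hi⟩ := h
  exact Finset.sum_pos' (fun i _ => sq_nonneg _)
    ⟨i, Finset.mem_univ _, pow_pos (lt_max_of_lt_left (by linarith)) 2⟩

/-- The Cauchy-Schwarz inequality on the active entries. -/
theorem sq_actSum_sub_le : (actSum x α - actCard x α * c) ^ 2 ≤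
    actCard x α * (actSq x α - 2 * c * actSum x α + actCard x α * c * c) := by
  rw [actSum_sub, actSq_sub, actCard]
  have := Finset.sum_mul_sq_le_sq_mul_sq Finset.univ (fun i => if α < x i then (1 : ℝ) else 0)
    (fun i => if α < x i then x i - c else 0)
  refine (le_of_eq_of_le ?_ this).trans_eq ?_
  · exact congrArg (· ^ 2) (Finset.sum_congr rfl fun i _ => by split_ifs <;> simp)
  · exact congrArg₂ (· * ·) (Finset.sum_congr rfl fun i _ => by split_ifs <;> simp)
      (Finset.sum_congr rfl fun i _ => by split_ifs <;> simp)

/-- The Cauchy-Schwarz inequality is strict unless the active entries are equal. -/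
theorem sq_actSum_lt {i j : Fin n} (hi : α < x i) (hij : x i < x j) :
    actSum x α * actSum x α < actCard x α * actSq x α := by
  -- Evaluate the sum of squares at the mean `c` of the active entries: it is positive because `x i`
  -- and `x j` cannot both equal `c`.
  have hd : 0 < actCard x α := actCard_pos ⟨i, hi⟩
  set c := actSum x α / actCard x α with hc
  have hpos : 0 < actSq x α - 2 * c * actSum x α + actCard x α * c * c := by
    rw [actSq_sub]
    obtain ⟨l, hl, hlc⟩ : ∃ l, α < x l ∧ x l - c ≠ 0 := by
      by_contra! h
      linarith [h i hi, h j (hi.trans hij)]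
    refine Finset.sum_pos' (fun i _ => by split_ifs <;> positivity) ⟨l, Finset.mem_univ _, ?_⟩
    rw [if_pos hl]
    positivity
  have e : actCard x α * c = actSum x α := by rw [hc]; field_simp
  nlinarith

end Active

/-! ## Monotonicity of the auxiliary function -/

section Monotone

variable {n : ℕ} {x : EuclideanSpace ℝ (Fin n)} {lam1 lam2 α β : ℝ}

/-- A division-free form of the comparison of `Ψ(β)` with `Ψ(α)`. Lowering the cut by `δ` adds `e`
to `max (x - β) 0`, with `0 ≤ e ≤ δ` everywhere and `e = δ` on the active entries. -/
theorem auxPsi_compare_aux (hαβ : α < β) (h : ∃ i, β < x i) :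
    ((∑ i, max (x i - β) 0) ^ 2 * ∑ i, max (x i - α) 0 ^ 2 ≤
      (∑ i, max (x i - α) 0) ^ 2 * ∑ i, max (x i - β) 0 ^ 2) ∧
    ((∃ i j, β < x i ∧ x i < x j) →
      (∑ i, max (x i - β) 0) ^ 2 * ∑ i, max (x i - α) 0 ^ 2 <
      (∑ i, max (x i - α) 0) ^ 2 * ∑ i, max (x i - β) 0 ^ 2) := by
  set Y := ∑ i, max (x i - β) 0 with hY
  set S := ∑ i, max (x i - β) 0 ^ 2 with hS
  set δ := β - α with hδ
  have hδ0 : 0 < δ := by linarith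
  set e : Fin n → ℝ := fun i => max (x i - α) 0 - max (x i - β) 0 with he
  have e0 : ∀ i, 0 ≤ e i := fun i => by
    simp only [he, sub_nonneg]; exact max_le_max (by linarith) le_rfl
  have e1 : ∀ i, e i ≤ δ := fun i => by
    simp only [he, hδ, sub_le_iff_le_add]
    exact max_le (by linarith [le_max_left (x i - β) 0]) (by linarith [le_max_right (x i - β) 0])
  have e2 : ∀ i, β < x i → e i = δ := fun i hi => by
    simp only [he, hδ]; rw [max_eq_left (by linarith), max_eq_left (by linarith)]; ring
  set E := ∑ i, e i with hE
  set F := ∑ i, e i ^ 2 with hF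
  have hW : ∑ i, max (x i - α) 0 = Y + E := by
    rw [hY, hE, ← Finset.sum_add_distrib]
    exact Finset.sum_congr rfl fun i _ => by simp [he]
  have hR : ∑ i, max (x i - α) 0 ^ 2 = S + 2 * δ * Y + F := by
    rw [hS, hY, hF, Finset.mul_sum, ← Finset.sum_add_distrib, ← Finset.sum_add_distrib]
    refine Finset.sum_congr rfl fun i _ => ?_
    rcases le_or_gt (x i) β with hi | hi
    · simp [he, max_eq_right (sub_nonpos.mpr hi)]
    · rw [← e2 i hi]; simp only [he]; ring
  have hFE : F ≤ δ * E := by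
    rw [hF, hE, Finset.mul_sum]
    exact Finset.sum_le_sum fun i _ => by nlinarith [e0 i, e1 i]
  have hEd : actCard x β * δ ≤ E := by
    rw [hE, actCard, Finset.sum_mul]
    refine Finset.sum_le_sum fun i _ => ?_
    split_ifs with hi
    · rw [e2 i hi, one_mul]
    · simpa using e0 i
  have hYe : actSum x β - actCard x β * β = Y := actSum_sub_eq (fun _ h => h.le) fun _ h => h
  have hSe : actSq x β - 2 * β * actSum x β + actCard x β * β * β = S :=
    actSq_sub_eq (fun _ h => h.le) fun _ h => h
  have hcs : Y ^ 2 ≤ actCard x β * S := by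
    have := sq_actSum_sub_le (x := x) (α := β) (c := β)
    rwa [hYe, hSe] at this
  have hd : 0 < actCard x β := actCard_pos h
  have hY0 : 0 < Y := sum_max_pos h
  have hS0 : 0 < S := sum_max_sq_pos h
  have hE0 : 0 < E := lt_of_lt_of_le (by positivity) hEd
  rw [hW, hR]
  -- Every term is non-negative by `hEd`, `hcs` or `hFE`. Strictness comes from the second term
  -- alone, through strict Cauchy-Schwarz.
  have id1 : (Y + E) ^ 2 * S - Y ^ 2 * (S + 2 * δ * Y + F) =
      2 * Y * S * (E - actCard x β * δ) + 2 * Y * δ * (actCard x β * S - Y ^ 2) +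
      E * S * (E - actCard x β * δ) + E * δ * (actCard x β * S - Y ^ 2) +
      Y ^ 2 * (δ * E - F) := by ring
  have n1 : 0 ≤ 2 * Y * S * (E - actCard x β * δ) := by
    have := sub_nonneg.mpr hEd; positivity
  have n2 : 0 ≤ E * S * (E - actCard x β * δ) := by
    have := sub_nonneg.mpr hEd; positivity
  have n3 : 0 ≤ E * δ * (actCard x β * S - Y ^ 2) := by
    have := sub_nonneg.mpr hcs; positivity
  have n4 : 0 ≤ Y ^ 2 * (δ * E - F) := by
    have := sub_nonneg.mpr hFE; positivity
  refine ⟨?_, ?_⟩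
  · have n5 : 0 ≤ 2 * Y * δ * (actCard x β * S - Y ^ 2) := by
      have := sub_nonneg.mpr hcs; positivity
    linarith
  · rintro ⟨i, j, hi, hij⟩
    have hcs' : 0 < actCard x β * S - Y ^ 2 := by
      rw [← hYe, ← hSe]
      have := sq_actSum_lt hi hij
      linarith
    have n5 : 0 < 2 * Y * δ * (actCard x β * S - Y ^ 2) := by positivity
    linarith

theorem auxPsi_anti (hαβ : α ≤ β) (h : ∃ i, β < x i) :
    auxPsi x lam1 lam2 β ≤ auxPsi x lam1 lam2 α := by
  rcases hαβ.eq_or_lt with rfl | hlt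
  · rfl
  have hα : ∃ i, α < x i := h.imp fun i hi => hlt.trans hi
  rw [auxPsi, auxPsi, sub_le_sub_iff_right, div_le_div_iff₀ (Real.sqrt_pos.mpr (sum_max_sq_pos h))
    (Real.sqrt_pos.mpr (sum_max_sq_pos hα))]
  have h1 := (sum_max_pos h).le
  have h2 := (sum_max_pos hα).le
  rw [← sq_le_sq₀ (by positivity) (by positivity), mul_pow, mul_pow,
    Real.sq_sqrt (sum_max_sq_pos h).le, Real.sq_sqrt (sum_max_sq_pos hα).le]
  exact (auxPsi_compare_aux hlt h).1

theorem auxPsi_strictAnti (hlt : α < β) {i j : Fin n} (hi : β < x i) (hij : x i < x j) :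
    auxPsi x lam1 lam2 β < auxPsi x lam1 lam2 α := by
  have h : ∃ i, β < x i := ⟨i, hi⟩
  have hα : ∃ i, α < x i := h.imp fun i hi => hlt.trans hi
  rw [auxPsi, auxPsi, sub_lt_sub_iff_right, div_lt_div_iff₀ (Real.sqrt_pos.mpr (sum_max_sq_pos h))
    (Real.sqrt_pos.mpr (sum_max_sq_pos hα))]
  have h1 := (sum_max_pos h).le
  have h2 := (sum_max_pos hα).le
  rw [← sq_lt_sq₀ (by positivity) (by positivity), mul_pow, mul_pow,
    Real.sq_sqrt (sum_max_sq_pos h).le, Real.sq_sqrt (sum_max_sq_pos hα).le]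
  exact (auxPsi_compare_aux hlt h).2 ⟨i, j, hi, hij⟩

theorem auxPsi_nonneg_iff (h2 : 0 < lam2) (h : ∃ i, α < x i) :
    0 ≤ auxPsi x lam1 lam2 α ↔
      lam1 * Real.sqrt (∑ i, max (x i - α) 0 ^ 2) ≤ lam2 * ∑ i, max (x i - α) 0 := by
  rw [auxPsi, sub_nonneg, div_le_div_iff₀ h2 (Real.sqrt_pos.mpr (sum_max_sq_pos h)),
    mul_comm lam2]

theorem exists_isSecondMax (h : ∃ i j, x i < x j) : ∃ u, IsSecondMax x u := by
  have hfin : {v | (∃ i, x i = v) ∧ ∃ j, v < x j}.Finite :=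
    (Set.finite_range fun i => x i).subset fun v hv => hv.1
  obtain ⟨i, j, hij⟩ := h
  exact hfin.exists_maximal ⟨x i, ⟨i, rfl⟩, j, hij⟩ |>.imp fun u hu =>
    ⟨hu.1, fun v hv => (le_total v u).elim id fun h => hu.2 hv h⟩

/-- Above `u` there are only the maximal entries, and they are equal, so the ratio of norms is the
square root of `maxMult x`. -/
theorem auxPsi_secondMax_neg (h1 : 0 < lam1) (h2 : 0 < lam2)
    (hm : (maxMult x : ℝ) * lam2 ^ 2 < lam1 ^ 2) {u : ℝ} (hu : IsSecondMax x u) :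
    auxPsi x lam1 lam2 u < 0 := by
  classical
  obtain ⟨j, hj⟩ := hu.1.2
  have : Nonempty (Fin n) := ⟨j⟩
  obtain ⟨i₀, hi₀⟩ := Finite.exists_max fun i => x i
  have hui : u < x i₀ := hj.trans_le (hi₀ j)
  have hact : ∀ i, u < x i → x i = x i₀ := by
    intro i hi
    by_contra hne
    exact hi.not_ge (hu.2 ⟨⟨i, rfl⟩, i₀, lt_of_le_of_ne (hi₀ i) hne⟩)
  have hval : ∀ i, max (x i - u) 0 = if ∀ j, x j ≤ x i then x i₀ - u else 0 := by
    intro i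
    split_ifs with h
    · rw [le_antisymm (hi₀ i) (h i₀), max_eq_left (by linarith)]
    · refine max_eq_right ?_
      by_contra! hlt
      exact h fun j => (hi₀ j).trans_eq (hact i (by linarith)).symm
  have hmul : maxMult x = (Finset.univ.filter fun i => ∀ j, x j ≤ x i).card := by
    rw [maxMult, ← Set.ncard_coe_finset]; simp
  have s1 : ∑ i, max (x i - u) 0 = maxMult x * (x i₀ - u) := by
    rw [Finset.sum_congr rfl fun i _ => hval i, ← Finset.sum_filter, Finset.sum_const, hmul,
      nsmul_eq_mul]
  have s2 : ∑ i, max (x i - u) 0 ^ 2 = maxMult x * (x i₀ - u) ^ 2 := by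
    have : ∀ i, max (x i - u) 0 ^ 2 = if ∀ j, x j ≤ x i then (x i₀ - u) ^ 2 else 0 := by
      intro i; rw [hval]; split_ifs <;> simp
    rw [Finset.sum_congr rfl fun i _ => this i, ← Finset.sum_filter, Finset.sum_const, hmul,
      nsmul_eq_mul]
  rw [← not_le, auxPsi_nonneg_iff h2 ⟨j, hj⟩, not_le]
  have hpos := sum_max_sq_pos ⟨j, hj⟩
  rw [← sq_lt_sq₀ (by have := (sum_max_pos ⟨j, hj⟩).le; positivity) (by positivity), mul_pow,
  mul_pow,
    Real.sq_sqrt hpos.le, s1]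
  rw [s2] at hpos ⊢
  nlinarith

/-- Take for `b` the least non-maximal entry with negative `Ψ`, and for `a` its predecessor among
`0` and the entries. Minimality of `b` gives `Ψ(a) ≥ 0`; monotonicity is not needed. -/
theorem exists_isRootBracket (hx : ∀ i, 0 ≤ x i) (h0 : 0 < auxPsi x lam1 lam2 0) {u : ℝ}
    (hu : IsSecondMax x u) (hneg : auxPsi x lam1 lam2 u < 0) :
    ∃ a b, IsRootBracket x lam1 lam2 a b := by
  classical
  obtain ⟨⟨i, rfl⟩, hj⟩ := hu.1
  set B := Finset.univ.filter fun i => auxPsi x lam1 lam2 (x i) < 0 ∧ ∃ j, x i < x j with hB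
  obtain ⟨l, hlB, hlmin⟩ := B.exists_min_image (fun i => x i) ⟨i, by simp [hB, hneg, hj]⟩
  obtain ⟨hl, hlj⟩ := (Finset.mem_filter.mp hlB).2
  set A : Finset ℝ := insert 0 ((Finset.univ.filter fun i => x i < x l).image fun i => x i) with hA
  obtain ⟨a, haA, hamax⟩ := A.exists_max_image id ⟨0, Finset.mem_insert_self _ _⟩
  have hl0 : 0 < x l := by
    refine lt_of_le_of_ne (hx l) fun h => ?_
    rw [← h] at hl
    exact lt_asymm hl h0
  have ha0 : 0 ≤ a := hamax 0 (Finset.mem_insert_self _ _)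
  have hadj : ∀ i, x i ≤ a ∨ x l ≤ x i := by
    intro i
    rcases lt_or_ge (x i) (x l) with h | h
    · exact Or.inl (hamax (x i) (Finset.mem_insert_of_mem (Finset.mem_image.mpr
        ⟨i, by simp [h], rfl⟩)))
    · exact Or.inr h
  refine ⟨a, x l, ?_⟩
  rcases Finset.mem_insert.mp haA with rfl | ha
  · exact ⟨Or.inl rfl, ⟨l, rfl⟩, hlj, ha0, hl0, hadj, h0.le, hl⟩
  · obtain ⟨r, hr, rfl⟩ := Finset.mem_image.mp ha
    have hrl : x r < x l := (Finset.mem_filter.mp hr).2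
    refine ⟨Or.inr ⟨r, rfl⟩, ⟨l, rfl⟩, hlj, ha0, hrl, hadj, ?_, hl⟩
    by_contra! hlt
    exact hrl.not_ge (hlmin r (Finset.mem_filter.mpr ⟨Finset.mem_univ _, hlt, l, hrl⟩))

end Monotone

/-! ## Thresholds from active sets -/

section ActiveThreshold

variable {n : ℕ} {x p : EuclideanSpace ℝ (Fin n)} {lam1 lam2 α xj xk : ℝ}

/-- The active set that belongs to `α` yields the projection. -/
structure IsGoodThreshold (x : EuclideanSpace ℝ (Fin n)) (lam1 lam2 d l1 l2 : ℝ) : Prop where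
  card_pos : 0 < d
  var_pos : 0 < d * l2 - l1 * l1
  den_pos : 0 < d * lam2 * lam2 - lam1 * lam1
  sum_eq : l1 - d * threshold lam1 lam2 d l1 l2 =
    ∑ i, max (x i - threshold lam1 lam2 d l1 l2) 0
  sum_sq_eq : l2 - 2 * threshold lam1 lam2 d l1 l2 * l1 +
    d * threshold lam1 lam2 d l1 l2 * threshold lam1 lam2 d l1 l2 =
    ∑ i, max (x i - threshold lam1 lam2 d l1 l2) 0 ^ 2

theorem IsGoodThreshold.sum_sq_pos {d l1 l2 : ℝ} (h2 : 0 < lam2)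
    (h : IsGoodThreshold x lam1 lam2 d l1 l2) :
    0 < ∑ i, max (x i - threshold lam1 lam2 d l1 l2) 0 ^ 2 := by
  obtain ⟨T, hT, -, e2, -⟩ := exists_scale h.card_pos h.var_pos h.den_pos
  rw [← h.sum_sq_eq, e2]
  positivity

theorem IsGoodThreshold.eq_proj {d l1 l2 : ℝ} (h2 : 0 < lam2)
    (hp : projSet (sparseSet n lam1 lam2) x = {p})
    (h : IsGoodThreshold x lam1 lam2 d l1 l2) (i : Fin n) :
    lam2 / Real.sqrt (∑ i, max (x i - threshold lam1 lam2 d l1 l2) 0 ^ 2) *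
      max (x i - threshold lam1 lam2 d l1 l2) 0 = p i := by
  obtain ⟨T, hT, e1, e2, -⟩ := exists_scale h.card_pos h.var_pos h.den_pos
  rw [h.sum_eq] at e1
  rw [h.sum_sq_eq] at e2
  have := mem_projSet_of_threshold h2 hT e1 e2
    (z := WithLp.toLp 2 fun i => max (x i - threshold lam1 lam2 d l1 l2) 0 / T) fun _ => rfl
  rw [hp, Set.mem_singleton_iff] at this
  rw [← this, e2, ← mul_pow, Real.sqrt_sq (by positivity)]
  field_simp

/-- The tests also supply what makes the threshold well defined. If all active entries were equal,
the strict test at `xk` would read `0 < 0`; hence Cauchy-Schwarz is strict. Inserted into the test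
at `xj`, this forces `lam1 ^ 2 < d * lam2 ^ 2`. Then the tests place the threshold in `[xj, xk)`. -/
theorem isGoodThreshold_of_tests (h1 : 0 < lam1) (h2 : 0 < lam2) (hxj : xj ≤ α)
    (hj : ∀ i, x i ≤ α → x i ≤ xj) (hxk : ∃ i, α < x i ∧ x i = xk)
    (hk : ∀ i, α < x i → xk ≤ x i)
    (tj : lam1 * Real.sqrt (actSq x α - 2 * xj * actSum x α + actCard x α * xj * xj) ≤
      lam2 * (actSum x α - actCard x α * xj))
    (tk : lam2 * (actSum x α - actCard x α * xk) <
      lam1 * Real.sqrt (actSq x α - 2 * xk * actSum x α + actCard x α * xk * xk)) :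
    IsGoodThreshold x lam1 lam2 (actCard x α) (actSum x α) (actSq x α) := by
  obtain ⟨k, hkα, rfl⟩ := hxk
  have hd : 0 < actCard x α := actCard_pos ⟨k, hkα⟩
  have hv : 0 < actCard x α * actSq x α - actSum x α * actSum x α := by
    by_contra! hv
    have hall : ∀ i, α < x i → x i = x k := by
      intro i hi
      by_contra hne
      have := sq_actSum_lt hkα (lt_of_le_of_ne (hk i hi) (Ne.symm hne))
      linarith
    rw [actSum_sub, actSq_sub, Finset.sum_eq_zero, Finset.sum_eq_zero] at tk
    · simp at tk
    · intro i _
      split_ifs with h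
      · simp [hall i h]
      · rfl
    · intro i _
      split_ifs with h
      · simp [hall i h]
      · rfl
  have hLj := actSum_sub_pos ⟨k, hkα⟩ (c := xj) fun i hi => hxj.trans_lt hi
  have hQj := actSq_sub_nonneg (x := x) (α := α) (c := xj)
  have hw : 0 < actCard x α * lam2 * lam2 - lam1 * lam1 := by
    have hsq := pow_le_pow_left₀ (by positivity) tj 2
    rw [mul_pow, mul_pow, Real.sq_sqrt hQj] at hsq
    have : 0 < (actCard x α * lam2 * lam2 - lam1 * lam1) *
        (actSq x α - 2 * xj * actSum x α + actCard x α * xj * xj) := by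
      nlinarith [mul_pos (pow_pos h2 2) hv]
    exact lt_of_not_ge fun h => this.not_ge (mul_nonpos_of_nonpos_of_nonneg h hQj)
  have hLk : 0 ≤ actSum x α - actCard x α * x k := by
    rw [actSum_sub]
    refine Finset.sum_nonneg fun i _ => ?_
    split_ifs with h
    · linarith [hk i h]
    · rfl
  have cj := (threshold_compare h1 h2 hd hv hw hLj.le).1.mp tj
  have ck : threshold lam1 lam2 _ _ _ < x k :=
    not_le.mp fun h => tk.not_ge ((threshold_compare h1 h2 hd hv hw hLk).1.mpr h)
  exact ⟨hd, hv, hw,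
    actSum_sub_eq (fun i hi => ck.le.trans (hk i hi)) fun i hi => (hj i hi).trans cj,
    actSq_sub_eq (fun i hi => ck.le.trans (hk i hi)) fun i hi => (hj i hi).trans cj⟩

theorem isGoodThreshold_of_auxPsi_nonpos (h1 : 0 < lam1) (h2 : 0 < lam2)
    (h1n : lam1 < Real.sqrt n * lam2) (hx : ∀ i, 0 ≤ x i) (hne : ∃ i j, x i < x j)
    (h0 : auxPsi x lam1 lam2 0 ≤ 0) :
    IsGoodThreshold x lam1 lam2 n (actSum x 0) (actSq x 0) := by
  obtain ⟨i, j, hij⟩ := hne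
  -- The cut `-1` makes all `n` entries active. Zero entries do not contribute to the sums, so the
  -- registers computed at cut `0` remain valid and only `d` has to change to `n`.
  have hm1 : ∀ i, -1 < x i := fun i => by linarith [hx i]
  have eS : actSum x 0 = actSum x (-1) := Finset.sum_congr rfl fun i _ => by
    rw [if_pos (hm1 i)]; split_ifs with h
    · rfl
    · exact le_antisymm (hx i) (not_lt.mp h)
  have eQ : actSq x 0 = actSq x (-1) := Finset.sum_congr rfl fun i _ => by
    rw [if_pos (hm1 i)]; split_ifs with h
    · rfl
    · rw [le_antisymm (not_lt.mp h) (hx i), zero_mul]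
  have ed : (n : ℝ) = actCard x (-1) := by simp [actCard, hm1]
  have hd : 0 < actCard x (-1) := actCard_pos ⟨i, hm1 i⟩
  have hv : 0 < actCard x (-1) * actSq x (-1) - actSum x (-1) * actSum x (-1) :=
    sub_pos.mpr (sq_actSum_lt (hm1 i) hij)
  have hw : 0 < actCard x (-1) * lam2 * lam2 - lam1 * lam1 := by
    have := pow_lt_pow_left₀ h1n h1.le two_ne_zero
    rw [mul_pow, Real.sq_sqrt (Nat.cast_nonneg n), ed] at this
    linarith
  rw [eS, eQ, ed]
  have hact : ∃ i, 0 < x i := ⟨j, (hx i).trans_lt hij⟩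
  have hs1 : actSum x (-1) - actCard x (-1) * 0 = ∑ i, max (x i - 0) 0 :=
    actSum_sub_eq (fun i _ => hx i) fun i hi => absurd (hm1 i) (not_lt.mpr hi)
  have hs2 : actSq x (-1) - 2 * 0 * actSum x (-1) + actCard x (-1) * 0 * 0 =
      ∑ i, max (x i - 0) 0 ^ 2 :=
    actSq_sub_eq (fun i _ => hx i) fun i hi => absurd (hm1 i) (not_lt.mpr hi)
  have hθ : threshold lam1 lam2 (actCard x (-1)) (actSum x (-1)) (actSq x (-1)) ≤ 0 := by
    rw [← (threshold_compare h1 h2 hd hv hw (c := 0)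
      (by rw [hs1]; exact (sum_max_pos hact).le)).2, hs1, hs2]
    rw [auxPsi, sub_nonpos, div_le_div_iff₀ (Real.sqrt_pos.mpr (sum_max_sq_pos hact)) h2] at h0
    linarith
  exact ⟨hd, hv, hw,
    actSum_sub_eq (fun i _ => hθ.trans (hx i)) fun i hi => absurd (hm1 i) (not_lt.mpr hi),
    actSq_sub_eq (fun i _ => hθ.trans (hx i)) fun i hi => absurd (hm1 i) (not_lt.mpr hi)⟩

end ActiveThreshold

/-! ## The evaluation of the auxiliary function -/

section Aux

variable {n : ℕ}

/-- The sum of `f` over the first `j` entries. -/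
def partialSum (f : Fin n → ℝ) (j : ℕ) : ℝ :=
  ∑ i with i.val < j, f i

theorem partialSum_zero (f : Fin n → ℝ) : partialSum f 0 = 0 := by simp [partialSum]

theorem partialSum_all (f : Fin n → ℝ) : partialSum f n = ∑ i, f i := by simp [partialSum]

theorem partialSum_succ (f : Fin n → ℝ) {j : ℕ} (hj : j < n) :
    partialSum f (j + 1) = partialSum f j + f ⟨j, hj⟩ := by
  have : (Finset.univ.filter fun i : Fin n => i.val < j + 1) =
      insert ⟨j, hj⟩ (Finset.univ.filter fun i : Fin n => i.val < j) := by
    ext i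
    simp only [Finset.mem_filter, Finset.mem_univ, true_and, Finset.mem_insert, Fin.ext_iff]
    omega
  rw [partialSum, this, Finset.sum_insert (by simp), add_comm]
  rfl

/-- A statement on the first `j + 1` entries follows from the one on the first `j` entries. -/
theorem forall_lt_succ {j : ℕ} {hj : j < n} {p : Fin n → Prop} (h : ∀ i : Fin n, i.val < j → p i)
    (h' : p ⟨j, hj⟩) : ∀ i : Fin n, i.val < j + 1 → p i := by
  intro i hi
  rcases Nat.lt_succ_iff_lt_or_eq.mp hi with h1 | h1
  · exact h i h1
  · rwa [show i = ⟨j, hj⟩ from Fin.ext h1]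

/-- The invariant of the scan through the vector `x`, after `j` entries. -/
structure ScanInv (x : EuclideanSpace ℝ (Fin n)) (α : ℝ) (j : ℕ) (reg : Reg → ℝ)
    (arr : Fin n → ℝ) : Prop where
  arr_eq : ∀ i, arr i = x i
  alpha : reg .alpha = α
  l1 : reg .l1 = partialSum (fun i => if α < x i then x i else 0) j
  l2sq : reg .l2sq = partialSum (fun i => if α < x i then x i * x i else 0) j
  d : reg .d = partialSum (fun i => if α < x i then 1 else 0) j
  dxj : reg .xj = α + reg .dxj
  xj_le : reg .xj ≤ α
  xj_nonneg : 0 ≤ reg .xj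
  xj_mem : reg .xj = 0 ∨ ∃ i, x i = reg .xj
  xj_ge : ∀ i : Fin n, i.val < j → x i ≤ α → x i ≤ reg .xj
  xk : (reg .d = 0 ∧ ∀ i : Fin n, i.val < j → x i ≤ α) ∨
    (1 ≤ reg .d ∧ reg .xk = α + reg .dxk ∧ (∃ i, α < x i ∧ x i = reg .xk) ∧
      ∀ i : Fin n, i.val < j → α < x i → reg .xk ≤ x i)

open Reg Cmd in
/-- The body of the scan. -/
def scanBody : Cmd := block [
    .assign t (.cell - alpha),
    .ite (.lt 0 t)
      (block [
        .assign l1 (l1 + .cell), .assign l2sq (l2sq + .cell * .cell), .assign d (d + 1),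
        .ite (.or (.eq d 1) (.lt t dxk))
          (block [.assign xk .cell, .assign dxk t])
          .skip])
      (.ite (.lt dxj t)
        (block [.assign xj .cell, .assign dxj t])
        .skip)]

open Reg Cmd in
/-- The part of the evaluation after the scan. -/
def auxTail : Cmd := block [
  .assign l1a (l1 - d * alpha),
  .assign l2asq (l2sq - 2 * alpha * l1 + d * alpha * alpha),
  .assign psi (l1a / .sqrt l2asq - lam1 / lam2),
  .assign dpsi (1 / .sqrt l2asq * (l1a * l1a / l2asq - d)),
  .assign ddpsi (3 * dpsi * l1a / l2asq),
  .assign psit (l1a * l1a / l2asq - lam1 * lam1 / (lam2 * lam2)),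
  .assign dpsit (2 * (l1a / .sqrt l2asq) * dpsi),
  .ite (.and
      (.le (lam1 * .sqrt (l2sq - 2 * xj * l1 + d * xj * xj)) (lam2 * (l1 - d * xj)))
      (.lt (lam2 * (l1 - d * xk)) (lam1 * .sqrt (l2sq - 2 * xk * l1 + d * xk * xk))))
    (.assign finished 1)
    (.assign finished 0)]

theorem scanBody_runs {x : EuclideanSpace ℝ (Fin n)} {α : ℝ} {j : ℕ} (hj : j < n)
    {s : State n} (hs : s.idx = j) (hI : ScanInv x α j s.reg s.arr) :
    Runs scanBody s fun s' => s'.idx = j ∧ ScanInv x α (j + 1) s'.reg s'.arr := by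
  obtain ⟨h1, h2, h3, h4, h5, h6, h7, h8, h9, h10, h11⟩ := hI
  subst hs
  have harr : s.arr ⟨s.idx, hj⟩ = x ⟨s.idx, hj⟩ := h1 _
  simp only [scanBody, Cmd.block, runs_seq, runs_assign, runs_ite, runs_skip, Expr.eval_hSub,
      Expr.ok_hSub, Expr.eval, Expr.Ok, Nat.cast_zero, Nat.cast_one, Test.Holds, Test.Ok, hj,
      dite_true, harr,
    h2, Function.update_apply, reduceCtorEq, if_true, if_false, true_and, and_true, sub_pos,
    sub_nonpos,
    not_lt, not_or]
  set ξ := x ⟨s.idx, hj⟩ with hξ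
  refine ⟨fun hlt => ⟨fun hnew => ?_, fun hold => ?_⟩, fun hle => ⟨fun hnew => ?_, fun hold => ?_⟩⟩
  · constructor <;> simp only [Function.update_apply, reduceCtorEq, if_true, if_false,
      partialSum_succ _ hj, ← hξ, if_pos hlt, h3, h4, h5, h2]
    all_goals try assumption
    · exact forall_lt_succ h10 fun h => absurd hlt (not_lt.mpr h)
    · right
      refine ⟨?_, by ring, ⟨_, hlt, rfl⟩, forall_lt_succ (fun i hi hα => ?_) fun _ => le_rfl⟩
      · rcases h11 with h | h <;> linarith [h.1]
      · rcases h11 with h | h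
        · exact absurd hα (not_lt.mpr (h.2 i hi))
        · rcases hnew with h' | h'
          · linarith [h.1]
          · linarith [h.2.2.2 i hi hα, h.2.1]
  · constructor <;> simp only [Function.update_apply, reduceCtorEq, if_true, if_false,
      partialSum_succ _ hj, ← hξ, if_pos hlt, h3, h4, h5, h2]
    all_goals try assumption
    · exact forall_lt_succ h10 fun h => absurd hlt (not_lt.mpr h)
    · right
      rcases h11 with h | h
      · exact absurd (by linarith [h.1]) hold.1
      · exact ⟨by linarith [h.1], h.2.1, h.2.2.1,
          forall_lt_succ h.2.2.2 fun _ => by linarith [h.2.1, hold.2]⟩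
  · constructor <;> simp only [Function.update_apply, reduceCtorEq, if_true, if_false,
      partialSum_succ _ hj, ← hξ, if_neg (not_lt.mpr hle), h3, h4, h5, h2, add_zero]
    all_goals try assumption
    · ring
    · linarith
    · exact Or.inr ⟨_, rfl⟩
    · exact forall_lt_succ (fun i hi hα => by linarith [h10 i hi hα]) fun _ => le_rfl
    · rw [← h5]
      rcases h11 with h | h
      · exact Or.inl ⟨h.1, forall_lt_succ h.2 hle⟩
      · exact Or.inr ⟨h.1, h.2.1, h.2.2.1,
          forall_lt_succ h.2.2.2 fun h => absurd h (not_lt.mpr hle)⟩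
  · constructor <;> simp only [Function.update_apply, reduceCtorEq, if_false,
      partialSum_succ _ hj, ← hξ, if_neg (not_lt.mpr hle), h3, h4, h5, h2, add_zero]
    all_goals try assumption
    · exact forall_lt_succ h10 fun _ => by linarith
    · rw [← h5]
      rcases h11 with h | h
      · exact Or.inl ⟨h.1, forall_lt_succ h.2 hle⟩
      · exact Or.inr ⟨h.1, h.2.1, h.2.2.1,
          forall_lt_succ h.2.2.2 fun h => absurd h (not_lt.mpr hle)⟩

/-- What `auxCmd` leaves in the registers. -/
structure AuxPost (x : EuclideanSpace ℝ (Fin n)) (lam1 lam2 α : ℝ) (reg : Reg → ℝ) : Prop where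
  l1 : reg .l1 = actSum x α
  l2sq : reg .l2sq = actSq x α
  d : reg .d = actCard x α
  xj_le : reg .xj ≤ α
  xj_nonneg : 0 ≤ reg .xj
  xj_mem : reg .xj = 0 ∨ ∃ i, x i = reg .xj
  xj_ge : ∀ i, x i ≤ α → x i ≤ reg .xj
  xk_mem : ∃ i, α < x i ∧ x i = reg .xk
  xk_le : ∀ i, α < x i → reg .xk ≤ x i
  psi : reg .psi = auxPsi x lam1 lam2 α
  finished : reg .finished ≠ 0 ↔
    lam1 * Real.sqrt (actSq x α - 2 * reg .xj * actSum x α + actCard x α * reg .xj * reg .xj) ≤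
      lam2 * (actSum x α - actCard x α * reg .xj) ∧
    lam2 * (actSum x α - actCard x α * reg .xk) <
      lam1 * Real.sqrt (actSq x α - 2 * reg .xk * actSum x α + actCard x α * reg .xk * reg .xk)

/-- An entry above `α` makes the sum of squares positive, so no division blocks; the radicands in
the final check are sums of squares. -/
theorem auxCmd_runs {x : EuclideanSpace ℝ (Fin n)} {lam1 lam2 α : ℝ} {s : State n}
    (h2 : 0 < lam2) (hα : 0 ≤ α) (hact : ∃ i, α < x i) (hs1 : s.reg .lam1 = lam1)
    (hs2 : s.reg .lam2 = lam2) (hsα : s.reg .alpha = α) (harr : ∀ i, s.arr i = x i) :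
    Runs auxCmd s fun s' => AuxPost x lam1 lam2 α s'.reg := by
  change Runs (.seq .probe (.seq (.assign .l1 0) (.seq (.assign .l2sq 0) (.seq (.assign .d 0)
    (.seq (.assign .xj 0) (.seq (.assign .dxj (0 - Expr.reg .alpha))
      (.seq (.forCells scanBody) auxTail))))))) s _
  simp only [runs_seq, runs_probe, runs_assign, Expr.eval_hSub, Expr.ok_hSub, Expr.eval, Expr.Ok,
      Nat.cast_zero, true_and, Function.update_apply, reduceCtorEq, if_false]
  have hscan := Runs.forCells (c := scanBody)
    (s := { s with reg := Function.update (Function.update (Function.update (Function.update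
      (Function.update s.reg .l1 0) .l2sq 0) .d 0) .xj 0) .dxj (0 - s.reg .alpha) })
    (ScanInv x α) (by
      constructor <;> simp [partialSum_zero, hsα, hα, harr])
    fun j hj s hs hI => scanBody_runs hj hs hI
  obtain ⟨s₁, t₁, k₁, h₁, hI⟩ := hscan
  have hr1 : s₁.reg .lam1 = lam1 := by
    rw [h₁.reg_eq (by decide)]; simpa [Function.update_apply] using hs1
  have hr2 : s₁.reg .lam2 = lam2 := by
    rw [h₁.reg_eq (by decide)]; simpa [Function.update_apply] using hs2
  refine ⟨s₁, t₁, k₁, h₁, ?_⟩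
  obtain ⟨g1, g2, g3, g4, g5, g6, g7, g8, g9, g10, g11⟩ := hI
  rw [partialSum_all] at g3 g4 g5
  change _ = actSum x α at g3
  change _ = actSq x α at g4
  change _ = actCard x α at g5
  obtain ⟨i₀, hi₀⟩ := hact
  -- The scan has met an active entry, so `xk` no longer holds its meaningless initial value.
  replace g11 := g11.resolve_left fun h => (h.2 i₀ i₀.2).not_gt hi₀
  have hS : actSum x α - actCard x α * α = ∑ i, max (x i - α) 0 :=
    actSum_sub_eq (fun _ h => h.le) fun _ h => h
  have hQ : actSq x α - 2 * α * actSum x α + actCard x α * α * α = ∑ i, max (x i - α) 0 ^ 2 :=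
    actSq_sub_eq (fun _ h => h.le) fun _ h => h
  have hQ0 := sum_max_sq_pos (x := x) ⟨i₀, hi₀⟩
  have hsq := (Real.sqrt_pos.mpr hQ0).ne'
  simp only [auxTail, Cmd.block, runs_seq, runs_assign, runs_ite, runs_skip, Expr.eval_hSub,
      Expr.eval_hDiv, Expr.ok_hSub, Expr.ok_hDiv, Expr.eval, Expr.Ok, Nat.cast_zero, Nat.cast_one,
      Nat.cast_ofNat, Test.Holds, Test.Ok,
    Function.update_apply, reduceCtorEq, if_true, if_false, true_and, and_true,
    g2, g3, g4, g5, hr1, hr2, hS, hQ, hQ0.le, hQ0.ne', hsq, h2.ne', mul_ne_zero, ne_eq,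
    not_false_eq_true, actSq_sub_nonneg]
  refine ⟨fun ht => ?_, fun ht => ?_⟩
  all_goals
    constructor <;> simp only [Function.update_apply, reduceCtorEq, if_true, if_false, g3, g4, g5]
    all_goals try assumption
    · exact fun i hi => g10 i i.2 hi
    · exact g11.2.2.1
    · exact fun i hi => g11.2.2.2 i i.2 hi
    · rfl
    · simp [ht]

theorem AuxPost.isGoodThreshold {x : EuclideanSpace ℝ (Fin n)} {lam1 lam2 α : ℝ} {reg : Reg → ℝ}
    (h1 : 0 < lam1) (h2 : 0 < lam2) (h : AuxPost x lam1 lam2 α reg) (hf : reg .finished ≠ 0) :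
    IsGoodThreshold x lam1 lam2 (reg .d) (reg .l1) (reg .l2sq) := by
  obtain ⟨tj, tk⟩ := h.finished.mp hf
  rw [h.d, h.l1, h.l2sq]
  exact isGoodThreshold_of_tests h1 h2 h.xj_le h.xj_ge h.xk_mem h.xk_le tj tk

/-- The search ends as soon as the bracket is hit. -/
theorem AuxPost.finished_of_bracket {x : EuclideanSpace ℝ (Fin n)} {lam1 lam2 α a b : ℝ}
    {reg : Reg → ℝ} (h2 : 0 < lam2) (h : AuxPost x lam1 lam2 α reg)
    (hab : IsRootBracket x lam1 lam2 a b) (ha : a ≤ α) (hb : α < b) : reg .finished ≠ 0 := by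
  obtain ⟨ha', ⟨l, hl⟩, hbx, ha0, hlt, hadj, hpa, hpb⟩ := hab
  -- No entry lies strictly between `a` and `b`, so these are the neighbours of `α` that the scan
  -- finds.
  have hxj : reg .xj = a := by
    apply le_antisymm
    · rcases h.xj_mem with h' | ⟨i, hi⟩
      · rwa [h']
      · rw [← hi]
        exact (hadj i).resolve_right (by linarith [h.xj_le])
    · rcases ha' with rfl | ⟨i, rfl⟩
      · exact h.xj_nonneg
      · exact h.xj_ge i ha
  have hxk : reg .xk = b := by
    apply le_antisymm
    · rw [← hl]; exact h.xk_le l (by linarith)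
    · obtain ⟨i, hi, hik⟩ := h.xk_mem
      rw [← hik]
      exact (hadj i).resolve_left (by linarith)
  -- The active set of `α` may be used at both cuts: entries equal to `b` are active but contribute
  -- zero at cut `b`.
  have sa : ∀ i, α < x i → a ≤ x i := fun i hi => by linarith
  have sa' : ∀ i, x i ≤ α → x i ≤ a := fun i hi => (hadj i).resolve_right (by linarith)
  have sb : ∀ i, α < x i → b ≤ x i := fun i hi => (hadj i).resolve_left (by linarith)
  have sb' : ∀ i, x i ≤ α → x i ≤ b := fun i hi => by linarith
  rw [h.finished, hxj, hxk, actSum_sub_eq sa sa', actSq_sub_eq sa sa', actSum_sub_eq sb sb',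
    actSq_sub_eq sb sb', ← auxPsi_nonneg_iff h2 (hbx.imp fun i hi => hlt.trans hi), ← not_le,
    ← auxPsi_nonneg_iff h2 hbx]
  exact ⟨hpa, not_le.mpr hpb⟩

end Aux

/-! ## The final phase -/

section Final

variable {n : ℕ}

open Reg Cmd in
/-- The first scan of the final phase, which subtracts the threshold. -/
def cutBody : Cmd := block [
    .assign t (.cell - alpha),
    .ite (.lt 0 t)
      (block [.store t, .assign rho (rho + t * t)])
      (.store 0)]

open Reg Cmd in
/-- The part of the algorithm after root-finding. -/
def finalCmd : Cmd := block [
  .assign alpha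
    (1 / d * (l1 - lam1 * .sqrt ((d * l2sq - l1 * l1) / (d * lam2 * lam2 - lam1 * lam1)))),
  .assign rho 0,
  forCells cutBody,
  forCells (.store (lam2 / .sqrt rho * .cell))]

theorem finalCmd_runs {x : EuclideanSpace ℝ (Fin n)} {lam1 lam2 d l1 l2 : ℝ} {s : State n}
    (h2 : 0 < lam2) (h : IsGoodThreshold x lam1 lam2 d l1 l2)
    (hs1 : s.reg .lam1 = lam1) (hs2 : s.reg .lam2 = lam2) (hd : s.reg .d = d)
    (hl1 : s.reg .l1 = l1) (hl2 : s.reg .l2sq = l2) (harr : ∀ i, s.arr i = x i) :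
    Runs finalCmd s fun s' => ∀ i, s'.arr i =
      lam2 / Real.sqrt (∑ i, max (x i - threshold lam1 lam2 d l1 l2) 0 ^ 2) *
        max (x i - threshold lam1 lam2 d l1 l2) 0 := by
  have hρ := h.sum_sq_pos h2
  have hroot : 0 ≤ (d * l2 - l1 * l1) / (d * lam2 * lam2 - lam1 * lam1) :=
    div_nonneg h.var_pos.le h.den_pos.le
  simp only [finalCmd, Cmd.block, runs_seq, runs_assign, runs_skip, Expr.eval_hSub, Expr.eval_hDiv,
      Expr.ok_hSub, Expr.ok_hDiv, Expr.eval, Expr.Ok, Nat.cast_zero, Nat.cast_one, true_and, hs1,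
    hs2, hd, hl1, hl2, h.card_pos.ne', h.den_pos.ne', ne_eq, not_false_eq_true, hroot]
  rw [← threshold]
  set θ := threshold lam1 lam2 d l1 l2
  -- In-place invariant: the cells before the pointer are already cut, the others still hold `x`.
  obtain ⟨s₁, t₁, k₁, h₁, ⟨e1, e2, e3, e4⟩⟩ := Runs.forCells (c := cutBody)
    (s := { s with reg := Function.update (Function.update s.reg .alpha θ) .rho 0 })
    (fun j reg arr => reg .alpha = θ ∧ reg .lam2 = lam2 ∧
      reg .rho = partialSum (fun i => max (x i - θ) 0 ^ 2) j ∧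
      ∀ i : Fin n, arr i = if i.val < j then max (x i - θ) 0 else x i)
    (by simp [partialSum_zero, hs2, harr])
    (by
      rintro j hj s rfl ⟨e1, e2, e3, e4⟩
      have harr : s.arr ⟨s.idx, hj⟩ = x ⟨s.idx, hj⟩ := by simp [e4]
      simp only [cutBody, Cmd.block, runs_seq, runs_assign, runs_ite, runs_skip, runs_store,
          Expr.eval_hSub, Expr.ok_hSub, Expr.eval, Expr.Ok, Nat.cast_zero, Test.Holds, Test.Ok, hj,
          dite_true, harr,
        Function.update_apply, reduceCtorEq, if_true, if_false, true_and, and_true, e1, e2, e3,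
        partialSum_succ _ hj, not_lt]
      refine ⟨fun hpos => ⟨trivial, ?_, fun i => ?_⟩, fun hneg => ⟨trivial, ?_, fun i => ?_⟩⟩
      · rw [max_eq_left hpos.le]; ring
      · rw [e4]
        rcases lt_trichotomy i.val s.idx with hi | hi | hi
        · rw [if_neg (by rintro rfl; exact lt_irrefl _ hi), if_pos hi, if_pos (by omega)]
        · obtain rfl : i = ⟨s.idx, hj⟩ := Fin.ext hi
          simp [max_eq_left hpos.le]
        · rw [if_neg (by rintro rfl; exact lt_irrefl _ hi), if_neg (by omega), if_neg (by omega)]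
      · rw [max_eq_right hneg]; ring
      · rw [e4]
        rcases lt_trichotomy i.val s.idx with hi | hi | hi
        · rw [if_neg (by rintro rfl; exact lt_irrefl _ hi), if_pos hi, if_pos (by omega)]
        · obtain rfl : i = ⟨s.idx, hj⟩ := Fin.ext hi
          simp [max_eq_right hneg]
        · rw [if_neg (by rintro rfl; exact lt_irrefl _ hi), if_neg (by omega), if_neg (by omega)])
  refine ⟨s₁, t₁, k₁, h₁, ?_⟩
  rw [partialSum_all] at e3
  refine (Runs.forCells (fun j reg arr => reg .lam2 = lam2 ∧
      reg .rho = ∑ i, max (x i - θ) 0 ^ 2 ∧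
      ∀ i : Fin n, arr i = if i.val < j then
        lam2 / Real.sqrt (∑ i, max (x i - θ) 0 ^ 2) * max (x i - θ) 0 else max (x i - θ) 0)
    ⟨e2, e3, by simp [e4]⟩ ?_).mono ?_
  · rintro j hj s rfl ⟨e1, e2, e3⟩
    have harr : s.arr ⟨s.idx, hj⟩ = max (x ⟨s.idx, hj⟩ - θ) 0 := by simp [e3]
    simp only [runs_store, Expr.eval_hDiv, Expr.ok_hDiv, Expr.eval,
      Expr.Ok, hj, dite_true, harr, e1, e2, hρ.le, (Real.sqrt_pos.mpr hρ).ne', true_and, and_true,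
      ne_eq, not_false_eq_true, Function.update_apply]
    refine ⟨trivial, fun i => ?_⟩
    rw [e3]
    rcases lt_trichotomy i.val s.idx with hi | hi | hi
    · rw [if_neg (by rintro rfl; exact lt_irrefl _ hi), if_pos hi, if_pos (by omega)]
    · obtain rfl : i = ⟨s.idx, hj⟩ := Fin.ext hi
      simp
    · rw [if_neg (by rintro rfl; exact lt_irrefl _ hi), if_neg (by omega), if_neg (by omega)]
  · rintro s' ⟨-, -, e⟩ i
    simp [e]

end Final

theorem Exec.exists_of_eq {n : ℕ} {c : Cmd} {s s' : State n} {t k k' : ℕ} (h : Exec c s s' t k)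
    (e : k = k') : ∃ t, Exec c s s' t k' :=
  ⟨t, e ▸ h⟩

/-! ## The search -/

section Search

variable {n : ℕ} {x : EuclideanSpace ℝ (Fin n)} {lam1 lam2 : ℝ} {solver : Solver}

open Reg Cmd in
/-- The part of the search before the first evaluation. -/
def searchInit : Cmd :=
  .seq (.assign lo 0) (.seq (.assign xmax 0)
    (.seq (forCells (.ite (.lt xmax .cell) (.assign xmax .cell) .skip))
      (.seq (.assign up 0)
        (.seq (forCells (.ite (.and (.not (.eq .cell xmax)) (.lt up .cell)) (.assign up .cell)
          .skip)) midpointCmd))))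

open Reg Cmd in
/-- One iteration of the search. -/
def searchBody (solver : Solver) : Cmd := block [
  .ite (.lt 0 psi) (.assign lo alpha) (.assign up alpha),
  stepCmd solver,
  auxCmd]

open Reg Cmd in
/-- The loop of the search. -/
def searchLoop (solver : Solver) : Cmd := .loop (.eq finished 0) (searchBody solver)

/-- Regroups the nested sequence into three stages. Only the probe count is tracked, as running
times are bounded separately. -/
theorem exec_searchCmd_iff {s s' : State n} {k : ℕ} :
    (∃ t, Exec (searchCmd solver) s s' t k) ↔
      ∃ s₁ s₂ t₁ t₂ t₃ k₁ k₂ k₃, Exec searchInit s s₁ t₁ k₁ ∧ Exec auxCmd s₁ s₂ t₂ k₂ ∧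
        Exec (searchLoop solver) s₂ s' t₃ k₃ ∧ k = k₁ + k₂ + k₃ := by
  constructor
  · rintro ⟨t, h⟩
    rcases h with _ | _ | _ | _ | _ | _ | ⟨a, _ | _ | _ | _ | _ | _ | ⟨b, _ | _ | _ | _ | _ | _ |
    ⟨c,
      _ | _ | _ | _ | _ | _ | ⟨d, _ | _ | _ | _ | _ | _ | ⟨e, _ | _ | _ | _ | _ | _ | ⟨f,
      _ | _ | _ | _ | _ | _ | ⟨g, _ | _ | _ | _ | _ | _ | ⟨h, h'⟩⟩⟩⟩⟩⟩⟩⟩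
    cases h'
    exact ⟨_, _, _, _, _, _, _, _, .seq a (.seq b (.seq c (.seq d (.seq e f)))), g, h, by omega⟩
  · rintro ⟨s₁, s₂, t₁, t₂, t₃, k₁, k₂, k₃, h, g, h', rfl⟩
    cases h with | seq a h =>
    cases h with | seq b h =>
    cases h with | seq c h =>
    cases h with | seq d h =>
    cases h with | seq e h =>
    have H := Exec.seq a (.seq b (.seq c (.seq d (.seq e (.seq h (.seq g (.seq h' (.skip s'))))))))
    exact H.exists_of_eq (by omega)

theorem searchInit_runs {s : State n} (hx : ∀ i, 0 ≤ x i) (hne : ∃ i j, x i < x j)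
    (harr : ∀ i, s.arr i = x i) :
    Runs searchInit s fun s' => s'.reg .lo = 0 ∧ IsSecondMax x (s'.reg .up) ∧
      s'.reg .alpha = s'.reg .lo + 1 / 2 * (s'.reg .up - s'.reg .lo) := by
  obtain ⟨p, q, hpq⟩ := hne
  simp only [searchInit, midpointCmd, runs_seq, runs_assign, Expr.eval_hSub, Expr.eval_hDiv,
    Expr.ok_hSub, Expr.ok_hDiv, Expr.eval, Expr.Ok, Nat.cast_zero, Nat.cast_one, Nat.cast_ofNat,
    true_and, and_true]
  refine (Runs.forCells (fun j reg arr => (∀ i, arr i = x i) ∧ reg .lo = 0 ∧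
    (reg .xmax = 0 ∨ ∃ i, x i = reg .xmax) ∧ ∀ i : Fin n, i.val < j → x i ≤ reg .xmax)
    (by simp [harr]) ?_).mono ?_
  · rintro j hj s rfl ⟨e1, e2, e3, e4⟩
    have harr : s.arr ⟨s.idx, hj⟩ = x ⟨s.idx, hj⟩ := e1 _
    simp only [runs_ite, runs_assign, runs_skip, Expr.eval, Expr.Ok, Test.Holds, Test.Ok, hj,
      dite_true, harr, Function.update_apply, reduceCtorEq, if_true, if_false, true_and, not_lt]
    exact ⟨fun h => ⟨e1, e2, Or.inr ⟨_, rfl⟩,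
        forall_lt_succ (fun i hi => (e4 i hi).trans h.le) le_rfl⟩,
      fun h => ⟨e1, e2, e3, forall_lt_succ e4 h⟩⟩
  rintro s₁ ⟨e1, e2, e3, e4⟩
  -- The start value `0` of `xmax` is not left over: some entry exceeds another non-negative one and
  -- is thus positive.
  obtain ⟨m, hm⟩ : ∃ m, x m = s₁.reg .xmax := by
    refine e3.resolve_left fun h => ?_
    linarith [hx p, e4 q q.2]
  refine (Runs.forCells (fun j reg arr => (∀ i, arr i = x i) ∧ reg .lo = 0 ∧ reg .xmax = x m ∧
    0 ≤ reg .up ∧ (reg .up = 0 ∨ ∃ i, x i = reg .up ∧ x i ≠ x m) ∧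
    ∀ i : Fin n, i.val < j → x i ≠ x m → x i ≤ reg .up)
    (by simp [e1, e2, hm]) ?_).mono ?_
  · rintro j hj s rfl ⟨f1, f2, f3, f4, f5, f6⟩
    have harr : s.arr ⟨s.idx, hj⟩ = x ⟨s.idx, hj⟩ := f1 _
    simp only [runs_ite, runs_assign, runs_skip, Expr.eval, Expr.Ok, Test.Holds, Test.Ok, hj, f3,
      dite_true, harr, Function.update_apply, reduceCtorEq, if_true, if_false, true_and]
    refine ⟨fun h => ⟨f1, f2, hx _, Or.inr ⟨_, rfl, h.1⟩,
        forall_lt_succ (fun i hi hne => (f6 i hi hne).trans h.2.le) fun _ => le_rfl⟩,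
      fun h => ⟨f1, f2, f4, f5, forall_lt_succ (hj := hj) f6 fun hne => ?_⟩⟩
    by_contra! hlt
    exact h ⟨hne, hlt⟩
  rintro s₂ ⟨f1, f2, f3, f4, f5, f6⟩
  have hlt : ∀ i, x i ≠ x m → x i < x m := fun i hi =>
    lt_of_le_of_ne ((e4 i i.2).trans_eq hm.symm) hi
  have hpm : x p ≠ x m := fun h => by linarith [e4 q q.2]
  simp only [Function.update_apply, reduceCtorEq, if_true, if_false, f2, true_and, ne_eq,
    OfNat.ofNat_ne_zero, not_false_eq_true, and_true]
  -- If `up` still has its start value `0`, the non-maximal entry `x p` must itself be `0`, so `up`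
  -- is an entry in any case.
  obtain ⟨i, hi, him⟩ : ∃ i, x i = s₂.reg .up ∧ x i ≠ x m := by
    rcases f5 with h | h
    · exact ⟨p, le_antisymm (f6 p p.2 hpm) (h.trans_le (hx p)), hpm⟩
    · exact h
  refine ⟨⟨⟨i, hi⟩, m, by rw [← hi]; exact hlt i him⟩, ?_⟩
  rintro _ ⟨⟨l, rfl⟩, r, hr⟩
  exact f6 l l.2 (hr.trans_le ((e4 r r.2).trans_eq hm.symm)).ne

/-- The invariant of the search. -/
structure SearchInv (x : EuclideanSpace ℝ (Fin n)) (lam1 lam2 : ℝ) (s : State n) : Prop where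
  arr_eq : ∀ i, s.arr i = x i
  lam1_eq : s.reg .lam1 = lam1
  lam2_eq : s.reg .lam2 = lam2
  lo_nonneg : 0 ≤ s.reg .lo
  lo_le : s.reg .lo ≤ s.reg .alpha
  le_up : s.reg .alpha ≤ s.reg .up
  up_lt : ∃ i, s.reg .up < x i
  post : AuxPost x lam1 lam2 (s.reg .alpha) s.reg

/-- The state in front of an evaluation within the search. -/
structure SearchPre (x : EuclideanSpace ℝ (Fin n)) (lam1 lam2 : ℝ) (s : State n) : Prop where
  arr_eq : ∀ i, s.arr i = x i
  lam1_eq : s.reg .lam1 = lam1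
  lam2_eq : s.reg .lam2 = lam2
  lo_nonneg : 0 ≤ s.reg .lo
  lo_le : s.reg .lo ≤ s.reg .alpha
  le_up : s.reg .alpha ≤ s.reg .up
  up_lt : ∃ i, s.reg .up < x i

theorem SearchPre.runs {s : State n} (h2 : 0 < lam2) (h : SearchPre x lam1 lam2 s) :
    Runs auxCmd s (SearchInv x lam1 lam2) := by
  obtain ⟨s', t, k, hE, hP⟩ := auxCmd_runs (x := x) h2 (h.lo_nonneg.trans h.lo_le)
    (h.up_lt.imp fun i hi => h.le_up.trans_lt hi) h.lam1_eq h.lam2_eq rfl h.arr_eq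
  have ha : s'.reg .alpha = s.reg .alpha := hE.reg_eq (by decide)
  have hl : s'.reg .lo = s.reg .lo := hE.reg_eq (by decide)
  have hu : s'.reg .up = s.reg .up := hE.reg_eq (by decide)
  refine ⟨s', t, k, hE, ?_, ?_, ?_, ?_, ?_, ?_, ?_, ?_⟩
  · rw [hE.arr_eq (by decide)]; exact h.arr_eq
  · rw [hE.reg_eq (by decide)]; exact h.lam1_eq
  · rw [hE.reg_eq (by decide)]; exact h.lam2_eq
  · rw [hl]; exact h.lo_nonneg
  · rw [hl, ha]; exact h.lo_le
  · rw [hu, ha]; exact h.le_up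
  · rw [hu]; exact h.up_lt
  · rwa [ha]

theorem midpointCmd_runs {s : State n} : Runs midpointCmd s fun s' =>
    s'.reg .alpha = s.reg .lo + 1 / 2 * (s.reg .up - s.reg .lo) := by
  simp [midpointCmd, runs_assign, Expr.eval_hSub, Expr.eval_hDiv, Expr.ok_hSub, Expr.ok_hDiv,
    Expr.eval, Expr.Ok]

theorem safeguard_always {s : State n} (h : s.reg .lo ≤ s.reg .up) :
    Always (.ite (.or (.lt (Expr.reg .alpha) (Expr.reg .lo)) (.lt (Expr.reg .up) (Expr.reg .alpha)))
      midpointCmd .skip) s fun s' => s.reg .lo ≤ s'.reg .alpha ∧ s'.reg .alpha ≤ s.reg .up := by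
  rw [always_ite]
  refine fun _ => ⟨fun _ => midpointCmd_runs.always.mono ?_, fun hn => always_skip.mpr ?_⟩
  · intro s' hs'
    rw [hs']
    constructor <;> linarith
  · simpa [Test.Holds, Expr.eval] using hn

/-- Nothing about the Newton-type formulas is used; the safeguard alone confines `alpha`. The claim
is partial because a derivative may vanish and block the step. -/
theorem stepCmd_always {s : State n} (h : s.reg .lo ≤ s.reg .up) :
    Always (stepCmd solver) s fun s' =>
      s.reg .lo ≤ s'.reg .alpha ∧ s'.reg .alpha ≤ s.reg .up := by
  have key : ∀ reg : Reg → ℝ, reg .lo = s.reg .lo → reg .up = s.reg .up →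
      Always (.ite (.or (.lt (Expr.reg .alpha) (Expr.reg .lo))
        (.lt (Expr.reg .up) (Expr.reg .alpha))) midpointCmd .skip) { s with reg := reg }
        fun s' => s.reg .lo ≤ s'.reg .alpha ∧ s'.reg .alpha ≤ s.reg .up := by
    intro reg h1 h2
    have := safeguard_always (s := { s with reg := reg }) (by simpa [h1, h2] using h)
    simpa [h1, h2] using this
  cases solver
  · refine midpointCmd_runs.always.mono ?_
    intro s' hs'
    rw [hs']
    constructor <;> linarith
  all_goals
    simp only [stepCmd, Cmd.block, always_seq, always_assign, always_skip]
    intros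
    refine key _ ?_ ?_ <;> simp

theorem stepCmd_keeps {r : Reg} (h : r ≠ .alpha) (h' : r ≠ .h) :
    (stepCmd solver).keeps r = true := by
  cases solver <;> simp [stepCmd, Cmd.block, Cmd.keeps, midpointCmd, h, h']

theorem stepCmd_keepsArr : (stepCmd solver).keepsArr = true := by
  cases solver <;> rfl

/-- Moving one endpoint to `alpha` keeps `lo ≤ up` and keeps `up` below some entry, which is all
that the next evaluation needs. -/
theorem searchBody_always {s : State n} (h2 : 0 < lam2) (h : SearchInv x lam1 lam2 s) :
    Always (searchBody solver) s (SearchInv x lam1 lam2) := by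
  intro s₄ _ _ hE
  cases hE with | @seq _ _ _ s₁ _ _ _ _ _ h₁ hE =>
  cases hE with | @seq _ _ _ s₂ _ _ _ _ _ h₂ hE =>
  cases hE with | seq h₃ hE =>
  cases hE
  have hb : 0 ≤ s₁.reg .lo ∧ s₁.reg .lo ≤ s₁.reg .up ∧ ∃ i, s₁.reg .up < x i := by
    refine (?_ : Always _ s fun s₁ => 0 ≤ s₁.reg .lo ∧ s₁.reg .lo ≤ s₁.reg .up ∧
      ∃ i, s₁.reg .up < x i) _ _ _ h₁
    rw [always_ite]
    refine fun _ => ⟨fun _ => ?_, fun _ => ?_⟩ <;>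
      simp only [always_assign, Expr.eval, Function.update_apply, reduceCtorEq, if_true, if_false]
    · exact fun _ => ⟨h.lo_nonneg.trans h.lo_le, h.le_up, h.up_lt⟩
    · exact fun _ => ⟨h.lo_nonneg, h.lo_le, h.up_lt.imp fun i hi => h.le_up.trans_lt hi⟩
  have hs := stepCmd_always hb.2.1 _ _ _ h₂
  have hl : s₂.reg .lo = s₁.reg .lo := h₂.reg_eq (stepCmd_keeps (by decide) (by decide))
  have hu : s₂.reg .up = s₁.reg .up := h₂.reg_eq (stepCmd_keeps (by decide) (by decide))
  refine (SearchPre.runs h2 ⟨?_, ?_, ?_, ?_, ?_, ?_, ?_⟩).always _ _ _ h₃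
  · rw [h₂.arr_eq stepCmd_keepsArr, h₁.arr_eq (by decide)]; exact h.arr_eq
  · rw [h₂.reg_eq (stepCmd_keeps (by decide) (by decide)), h₁.reg_eq (by decide)]
    exact h.lam1_eq
  · rw [h₂.reg_eq (stepCmd_keeps (by decide) (by decide)), h₁.reg_eq (by decide)]
    exact h.lam2_eq
  · rw [hl]; exact hb.1
  · rw [hl]; exact hs.1
  · rw [hu]; exact hs.2
  · rw [hu]; exact hb.2.2

theorem searchInit_pre {s s' : State n} {t k : ℕ} (hx : ∀ i, 0 ≤ x i) (hne : ∃ i j, x i < x j)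
    (hs1 : s.reg .lam1 = lam1) (hs2 : s.reg .lam2 = lam2) (harr : ∀ i, s.arr i = x i)
    (h : Exec searchInit s s' t k) : SearchPre x lam1 lam2 s' := by
  obtain ⟨e1, e2, e3⟩ := (searchInit_runs hx hne harr).always _ _ _ h
  have hup : 0 ≤ s'.reg .up := by
    obtain ⟨i, hi⟩ := e2.1.1
    exact hi ▸ hx i
  refine ⟨?_, ?_, ?_, e1.ge, ?_, ?_, e2.1.2⟩
  · rw [h.arr_eq (by decide)]; exact harr
  · rw [h.reg_eq (by decide)]; exact hs1
  · rw [h.reg_eq (by decide)]; exact hs2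
  · rw [e3, e1]; linarith
  · rw [e3, e1]; linarith

theorem searchCmd_always {s : State n} (h2 : 0 < lam2) (hx : ∀ i, 0 ≤ x i)
    (hne : ∃ i j, x i < x j) (hs1 : s.reg .lam1 = lam1) (hs2 : s.reg .lam2 = lam2)
    (harr : ∀ i, s.arr i = x i) :
    Always (searchCmd solver) s fun s' => SearchInv x lam1 lam2 s' ∧ s'.reg .finished ≠ 0 := by
  intro s' t k h
  obtain ⟨s₁, s₂, t₁, t₂, t₃, k₁, k₂, k₃, h₁, h₂, h₃, -⟩ := exec_searchCmd_iff.mp ⟨t, h⟩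
  have hI := ((searchInit_pre hx hne hs1 hs2 harr h₁).runs h2).always _ _ _ h₂
  obtain ⟨hP, hf⟩ := Always.loop hI (fun s hs _ => searchBody_always h2 hs) _ _ _ h₃
  exact ⟨hP, by simpa [Test.Holds, Expr.eval] using hf⟩

end Search

/-! ## Running time of the algorithm -/

/-- Every run passes at least `m` probes, and takes `O(n)` operations per probe, except for an
additional `O(n)`. -/
def ProbeCost (c : Cmd) (m : ℕ) : Prop :=
  ∃ A : ℕ, ∀ (n : ℕ) (s s' : State n) (t k : ℕ), 0 < n → Exec c s s' t k →
    t ≤ A * n * (k + 1) ∧ m ≤ k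

theorem LinCost.probeCost {c : Cmd} {m : ℕ} (hc : LinCost c m) : ProbeCost c m := by
  obtain ⟨A, hA⟩ := hc
  refine ⟨A, fun n s s' t k hn h => ?_⟩
  obtain ⟨h₁, h₂⟩ := hA _ _ _ _ _ hn h
  exact ⟨h₁.trans (Nat.le_mul_of_pos_right _ k.succ_pos), h₂.ge⟩

theorem ProbeCost.seq {c c' : Cmd} {m m' : ℕ} (hc : ProbeCost c m) (hc' : ProbeCost c' m') :
    ProbeCost (.seq c c') (m + m') := by
  obtain ⟨A, hA⟩ := hc
  obtain ⟨B, hB⟩ := hc'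
  refine ⟨A + B, fun n s s' t k hn h => ?_⟩
  cases h with
  | @seq _ _ _ s₁ _ t t' k k' h h' =>
    obtain ⟨h₁, h₂⟩ := hA _ _ _ _ _ hn h
    obtain ⟨g₁, g₂⟩ := hB _ _ _ _ _ hn h'
    refine ⟨?_, by omega⟩
    have e : (A + B) * n * (k + k' + 1) =
      A * n * (k + 1) + B * n * (k' + 1) + (A * n * k' + B * n * k) := by ring
    rw [e]
    exact (add_le_add h₁ g₁).trans (Nat.le_add_right _ _)

theorem ProbeCost.ite {p : Test} {c c' : Cmd} {m m' : ℕ} (hc : ProbeCost c m)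
    (hc' : ProbeCost c' m') : ProbeCost (.ite p c c') (min m m') := by
  obtain ⟨A, hA⟩ := hc
  obtain ⟨B, hB⟩ := hc'
  refine ⟨p.ops + A + B, fun n s s' t k hn h => ?_⟩
  have e : (p.ops + A + B) * n * (k + 1) =
      p.ops * (n * (k + 1)) + A * n * (k + 1) + B * n * (k + 1) := by ring
  have hp : p.ops ≤ p.ops * (n * (k + 1)) := Nat.le_mul_of_pos_right _ (by positivity)
  rw [e]
  cases h with
  | iteTrue _ _ h => obtain ⟨h₁, h₂⟩ := hA _ _ _ _ _ hn h; exact ⟨by omega, by omega⟩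
  | iteFalse _ _ h => obtain ⟨h₁, h₂⟩ := hB _ _ _ _ _ hn h; exact ⟨by omega, by omega⟩

/-- One probe per pass makes the probe count the number of passes; the extra `1` pays for the final
test. -/
theorem LinCost.loop {p : Test} {c : Cmd} (hc : LinCost c 1) : ProbeCost (.loop p c) 0 := by
  obtain ⟨A, hA⟩ := hc
  suffices H : ∀ (n : ℕ) (d : Cmd) (s s' : State n) (t k : ℕ), 0 < n → Exec d s s' t k →
      d = .loop p c → t ≤ (p.ops + A) * n * (k + 1) from
    ⟨p.ops + A, fun n s s' t k hn h => ⟨H n _ s s' t k hn h rfl, k.zero_le⟩⟩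
  intro n d s s' t k hn h
  have hp : p.ops ≤ p.ops * n := Nat.le_mul_of_pos_right _ hn
  induction h with
  | loopDone ok hq =>
    intro hd
    cases hd
    rw [zero_add, mul_one, add_mul]
    exact hp.trans (Nat.le_add_right _ _)
  | @loopStep q _ s s' s'' t t' k k' ok hq h h' ih ih' =>
    intro hd
    cases hd
    obtain ⟨h₁, rfl⟩ := hA _ _ _ _ _ hn h
    have e : (p.ops + A) * n * (1 + k' + 1) =
        p.ops * n + A * n + (p.ops + A) * n * (k' + 1) := by ring
    rw [e]
    exact add_le_add (add_le_add hp h₁) (ih' rfl)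
  | _ => intro hd; cases hd

theorem linCost_auxCmd : LinCost auxCmd 1 := by
  have hbody : ConstCost scanBody :=
    .seq (.assign _ _) (.seq (.ite (.seq (.assign _ _) (.seq (.assign _ _) (.seq (.assign _ _)
      (.seq (.ite (.seq (.assign _ _) (.seq (.assign _ _) .skip)) .skip) .skip))))
      (.ite (.seq (.assign _ _) (.seq (.assign _ _) .skip)) .skip)) .skip)
  have htail : ConstCost auxTail :=
    .seq (.assign _ _) (.seq (.assign _ _) (.seq (.assign _ _) (.seq (.assign _ _)
      (.seq (.assign _ _) (.seq (.assign _ _) (.seq (.assign _ _)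
        (.seq (.ite (.assign _ _) (.assign _ _)) .skip)))))))
  have hinit : ∀ (r : Reg) (e : Expr), LinCost (.assign r e) 0 := fun r e =>
    (ConstCost.assign r e).linCost
  exact LinCost.seq .probe ((hinit _ _).seq ((hinit _ _).seq ((hinit _ _).seq ((hinit _ _).seq
    ((hinit _ _).seq ((LinCost.forCells hbody).seq htail.linCost))))))

theorem constCost_midpointCmd : ConstCost midpointCmd := .assign _ _

theorem constCost_stepCmd (solver : Solver) : ConstCost (stepCmd solver) := by
  have hm := constCost_midpointCmd
  cases solver
  · exact hm
  · exact .seq (.assign _ _) (.seq (.ite hm .skip) .skip)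
  · exact .seq (.assign _ _) (.seq (.ite hm .skip) .skip)
  · exact .seq (.assign _ _) (.seq (.assign _ _) (.seq (.assign _ _) (.seq (.ite hm .skip) .skip)))

theorem linCost_searchBody (solver : Solver) : LinCost (searchBody solver) 1 :=
  (ConstCost.ite (.assign _ _) (.assign _ _)).linCost.seq
    ((constCost_stepCmd solver).linCost.seq (linCost_auxCmd.seq ConstCost.skip.linCost))

theorem linCost_searchInit : LinCost searchInit 0 :=
  (ConstCost.assign _ _).linCost.seq ((ConstCost.assign _ _).linCost.seq
    ((LinCost.forCells (.ite (.assign _ _) .skip)).seq ((ConstCost.assign _ _).linCost.seq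
      ((LinCost.forCells (.ite (.assign _ _) .skip)).seq constCost_midpointCmd.linCost))))

theorem probeCost_searchCmd (solver : Solver) : ProbeCost (searchCmd solver) 1 := by
  have h1 : ∀ (r : Reg) (e : Expr), ProbeCost (.assign r e) 0 := fun r e =>
    (ConstCost.assign r e).linCost.probeCost
  have h2 : ∀ (p : Test) (r : Reg) (e : Expr), ProbeCost (.forCells (.ite p (.assign r e) .skip)) 0
  :=
    fun p r e => (LinCost.forCells (.ite (.assign _ _) .skip)).probeCost
  exact (h1 _ _).seq ((h1 _ _).seq ((h2 _ _ _).seq ((h1 _ _).seq ((h2 _ _ _).seq ((h1 _ _).seq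
    (linCost_auxCmd.probeCost.seq ((linCost_searchBody solver).loop.seq
      ConstCost.skip.linCost.probeCost)))))))

theorem linCost_finalCmd : LinCost finalCmd 0 :=
  (ConstCost.assign _ _).linCost.seq ((ConstCost.assign _ _).linCost.seq
    ((LinCost.forCells (.seq (.assign _ _) (.seq (.ite (.seq (.store _) (.seq (.assign _ _) .skip))
      (.store _)) .skip))).seq ((LinCost.forCells (.store _)).seq ConstCost.skip.linCost)))

theorem probeCost_projCmd (solver : Solver) : ProbeCost (projCmd solver) 1 :=
  (ConstCost.assign _ _).linCost.probeCost.seq (linCost_auxCmd.probeCost.seq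
    (((ConstCost.assign _ _).linCost.probeCost.ite (probeCost_searchCmd solver)).seq
      linCost_finalCmd.probeCost))

/-! ## Correctness of the algorithm -/

section Correct

variable {n : ℕ} {x p : EuclideanSpace ℝ (Fin n)} {lam1 lam2 : ℝ} {solver : Solver} {s : State n}

theorem exec_projCmd_iff {s' : State n} {k : ℕ} :
    (∃ t, Exec (projCmd solver) s s' t k) ↔
      ∃ s₁ s₂ t₁ t₂ t₃ k₁ k₂ k₃,
        Exec auxCmd { s with reg := Function.update s.reg .alpha 0 } s₁ t₁ k₁ ∧
        Exec (.ite (.le (Expr.reg .psi) 0) (.assign .d .len) (searchCmd solver)) s₁ s₂ t₂ k₂ ∧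
        Exec finalCmd s₂ s' t₃ k₃ ∧ k = k₁ + k₂ + k₃ := by
  have e : ((0 : Expr).eval s) = 0 := by simp [Expr.eval]
  constructor
  · rintro ⟨t, h⟩
    cases h with | seq a h =>
    cases h with | seq b h =>
    cases h with | seq c h =>
    cases a
    rw [e] at b
    exact ⟨_, _, _, _, _, _, _, _, b, c, h, by omega⟩
  · rintro ⟨s₁, s₂, t₁, t₂, t₃, k₁, k₂, k₃, a, b, c, rfl⟩
    have h := Exec.assign s .alpha 0 trivial
    rw [e] at h
    have H := Exec.seq h (.seq a (.seq b c))
    exact H.exists_of_eq (by omega)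

theorem auxCmd_zero_runs (h2 : 0 < lam2) (hx : ∀ i, 0 ≤ x i) (hne : ∃ i j, x i < x j)
    (hs1 : s.reg .lam1 = lam1) (hs2 : s.reg .lam2 = lam2) (harr : ∀ i, s.arr i = x i) :
    Runs auxCmd { s with reg := Function.update s.reg .alpha 0 } fun s' =>
      AuxPost x lam1 lam2 0 s'.reg ∧ s'.reg .lam1 = lam1 ∧ s'.reg .lam2 = lam2 ∧
        ∀ i, s'.arr i = x i := by
  obtain ⟨i, j, hij⟩ := hne
  obtain ⟨s', t, k, h, hP⟩ := auxCmd_runs (x := x) (lam1 := lam1)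
    (s := { s with reg := Function.update s.reg .alpha 0 }) h2 le_rfl
    ⟨j, (hx i).trans_lt hij⟩ (by simpa [Function.update_apply] using hs1)
    (by simpa [Function.update_apply] using hs2) (by simp) harr
  refine ⟨s', t, k, h, hP, ?_, ?_, ?_⟩
  · rw [h.reg_eq (by decide)]; simpa [Function.update_apply] using hs1
  · rw [h.reg_eq (by decide)]; simpa [Function.update_apply] using hs2
  · rw [h.arr_eq (by decide)]; exact harr

/-- What has to hold in front of the final phase. -/
structure FinalPre (x : EuclideanSpace ℝ (Fin n)) (lam1 lam2 : ℝ) (s : State n) : Prop where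
  arr_eq : ∀ i, s.arr i = x i
  lam1_eq : s.reg .lam1 = lam1
  lam2_eq : s.reg .lam2 = lam2
  good : IsGoodThreshold x lam1 lam2 (s.reg .d) (s.reg .l1) (s.reg .l2sq)

theorem FinalPre.runs (h2 : 0 < lam2) (hp : projSet (sparseSet n lam1 lam2) x = {p})
    (h : FinalPre x lam1 lam2 s) : Runs finalCmd s fun s' => ∀ i, s'.arr i = p i :=
  (finalCmd_runs h2 h.good h.lam1_eq h.lam2_eq rfl rfl rfl h.arr_eq).mono fun s' hs i => by
    rw [hs, h.good.eq_proj h2 hp]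

theorem SearchInv.finalPre (h1 : 0 < lam1) (h2 : 0 < lam2) (h : SearchInv x lam1 lam2 s)
    (hf : s.reg .finished ≠ 0) : FinalPre x lam1 lam2 s :=
  ⟨h.arr_eq, h.lam1_eq, h.lam2_eq, h.post.isGoodThreshold h1 h2 hf⟩

theorem assign_len_runs (h1 : 0 < lam1) (h2 : 0 < lam2) (h1n : lam1 < Real.sqrt n * lam2)
    (hx : ∀ i, 0 ≤ x i) (hne : ∃ i j, x i < x j) (h0 : auxPsi x lam1 lam2 0 ≤ 0)
    (hP : AuxPost x lam1 lam2 0 s.reg) (hs1 : s.reg .lam1 = lam1) (hs2 : s.reg .lam2 = lam2)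
    (harr : ∀ i, s.arr i = x i) :
    Runs (.assign .d .len) s (FinalPre x lam1 lam2) := by
  refine runs_assign.mpr ⟨trivial, harr, ?_, ?_, ?_⟩
  · simpa [Function.update_apply] using hs1
  · simpa [Function.update_apply] using hs2
  · simpa [Function.update_apply, hP.l1, hP.l2sq, Expr.eval] using
      isGoodThreshold_of_auxPsi_nonpos h1 h2 h1n hx hne h0

theorem psi_test {reg : Reg → ℝ} (hs : s.reg = reg) (hP : AuxPost x lam1 lam2 0 reg) :
    (Test.le (Expr.reg .psi) 0).Holds s ↔ auxPsi x lam1 lam2 0 ≤ 0 := by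
  simp [Test.Holds, Expr.eval, hs, hP.psi]

theorem projCmd_always (h1 : 0 < lam1) (h2 : 0 < lam2) (h1n : lam1 < Real.sqrt n * lam2)
    (hx : ∀ i, 0 ≤ x i) (hne : ∃ i j, x i < x j)
    (hp : projSet (sparseSet n lam1 lam2) x = {p})
    (hs1 : s.reg .lam1 = lam1) (hs2 : s.reg .lam2 = lam2) (harr : ∀ i, s.arr i = x i) :
    Always (projCmd solver) s fun s' => ∀ i, s'.arr i = p i := by
  intro s' t k h
  obtain ⟨s₁, s₂, t₁, t₂, t₃, k₁, k₂, k₃, ha, hb, hc, -⟩ := exec_projCmd_iff.mp ⟨t, h⟩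
  obtain ⟨hP, e1, e2, e3⟩ := (auxCmd_zero_runs h2 hx hne hs1 hs2 harr).always _ _ _ ha
  have hF : FinalPre x lam1 lam2 s₂ := by
    cases hb with
    | iteTrue _ ht hb =>
      rw [psi_test rfl hP] at ht
      exact (assign_len_runs h1 h2 h1n hx hne ht hP e1 e2 e3).always _ _ _ hb
    | iteFalse _ _ hb =>
      obtain ⟨hI, hf⟩ := searchCmd_always h2 hx hne e1 e2 e3 _ _ _ hb
      exact hI.finalPre h1 h2 hf
  exact (hF.runs h2 hp).always _ _ _ hc

theorem projCmd_runs_of_nonpos (h1 : 0 < lam1) (h2 : 0 < lam2) (h1n : lam1 < Real.sqrt n * lam2)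
    (hx : ∀ i, 0 ≤ x i) (hne : ∃ i j, x i < x j)
    (hp : projSet (sparseSet n lam1 lam2) x = {p}) (h0 : auxPsi x lam1 lam2 0 ≤ 0) (hn : 0 < n)
    (hs1 : s.reg .lam1 = lam1) (hs2 : s.reg .lam2 = lam2) (harr : ∀ i, s.arr i = x i) :
    ∃ s' t, Exec (projCmd solver) s s' t 1 := by
  obtain ⟨s₁, t₁, k₁, ha, hP, e1, e2, e3⟩ := auxCmd_zero_runs h2 hx hne hs1 hs2 harr
  obtain ⟨s₂, t₂, k₂, hb, hF⟩ := assign_len_runs h1 h2 h1n hx hne h0 hP e1 e2 e3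
  obtain ⟨s₃, t₃, k₃, hc, -⟩ := hF.runs h2 hp
  obtain ⟨A, hA⟩ := linCost_auxCmd
  obtain ⟨B, hB⟩ := (ConstCost.assign .d .len).linCost
  obtain ⟨C, hC⟩ := linCost_finalCmd
  have ka := (hA _ _ _ _ _ hn ha).2
  have kb := (hB _ _ _ _ _ hn hb).2
  have kc := (hC _ _ _ _ _ hn hc).2
  exact ⟨s₃, exec_projCmd_iff.mpr ⟨s₁, s₂, _, _, _, _, _, _, ha,
    .iteTrue ⟨trivial, trivial⟩ ((psi_test rfl hP).mpr h0) hb, hc, by omega⟩⟩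

/-- Each iteration of bisection halves the interval, which always contains the bracket. -/
theorem bisection_loop {a b u : ℝ} (h2 : 0 < lam2) (hn : 0 < n)
    (hab : IsRootBracket x lam1 lam2 a b) :
    ∀ (r j : ℕ) (s : State n), SearchInv x lam1 lam2 s → s.reg .lo ≤ a → b ≤ s.reg .up →
      s.reg .up - s.reg .lo = u / 2 ^ j →
      s.reg .alpha = s.reg .lo + 1 / 2 * (s.reg .up - s.reg .lo) → u < 2 ^ (j + r) * (b - a) →
      ∃ s' t k, Exec (searchLoop .bisection) s s' t k ∧ 2 ^ (j + k) * (b - a) ≤ u := by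
  have hab' := hab
  obtain ⟨-, ⟨l, hl⟩, ⟨q, hq⟩, ha0, hlt, -, hpa, hpb⟩ := hab'
  -- The bracket fits into the current interval. This gives the bound on the number of passes and
  -- also contradicts running out of the fuel `r`.
  have hlen : ∀ (j : ℕ) (s : State n), s.reg .lo ≤ a → b ≤ s.reg .up →
      s.reg .up - s.reg .lo = u / 2 ^ j → 2 ^ j * (b - a) ≤ u := by
    intro j s hlo hup hlen
    have : b - a ≤ u / 2 ^ j := by linarith
    rwa [le_div_iff₀ (by positivity), mul_comm] at this
  intro r
  induction r with
  | zero =>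
    intro j s _ hlo hup hl' _ hlt'
    exact absurd (hlen j s hlo hup hl') (not_le.mpr hlt')
  | succ r ih =>
    intro j s hI hlo hup hl' hα hlt'
    by_cases hf : s.reg .finished = 0
    · have hhold : (Test.eq (Expr.reg .finished) 0).Holds s := by
        simpa [Test.Holds, Expr.eval] using hf
      -- As long as the check fails, `alpha` lies outside `[a, b)`. On the left, strict monotonicity
      -- is essential: `Ψ(a)` may be `0`, yet `lo` has to move.
      have hcase : (0 < s.reg .psi ∧ s.reg .alpha ≤ a) ∨ (¬ 0 < s.reg .psi ∧ b ≤ s.reg .alpha) := by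
        rcases lt_or_ge (s.reg .alpha) a with h | h
        · left
          rw [hI.post.psi]
          exact ⟨hpa.trans_lt (auxPsi_strictAnti h (hl ▸ hlt) (hl ▸ hq)), h.le⟩
        · right
          have hb : b ≤ s.reg .alpha := by
            by_contra! hb
            exact hI.post.finished_of_bracket h2 hab h hb hf
          rw [hI.post.psi]
          refine ⟨not_lt.mpr (le_trans (auxPsi_anti hb ?_) hpb.le), hb⟩
          exact hI.up_lt.imp fun i hi => hI.le_up.trans_lt hi
      obtain ⟨s₁, t₁, k₁, h₁, hb⟩ : Runs (searchBody .bisection) s fun s' =>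
          s'.reg .lo ≤ a ∧ b ≤ s'.reg .up ∧ s'.reg .up - s'.reg .lo = u / 2 ^ (j + 1) ∧
          s'.reg .alpha = s'.reg .lo + 1 / 2 * (s'.reg .up - s'.reg .lo) := by
        have hfin : ∀ reg : Reg → ℝ, reg .lam1 = lam1 → reg .lam2 = lam2 → 0 ≤ reg .lo →
            reg .lo ≤ a → b ≤ reg .up → (∃ i, reg .up < x i) →
            reg .up - reg .lo = u / 2 ^ (j + 1) →
            reg .alpha = reg .lo + 1 / 2 * (reg .up - reg .lo) →
            Runs auxCmd { s with reg := reg } fun s' => s'.reg .lo ≤ a ∧ b ≤ s'.reg .up ∧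
              s'.reg .up - s'.reg .lo = u / 2 ^ (j + 1) ∧
              s'.reg .alpha = s'.reg .lo + 1 / 2 * (s'.reg .up - s'.reg .lo) := by
          intro reg f1 f2 f3 f4 f5 f6 f7 f8
          obtain ⟨s', t, k, h, -⟩ := SearchPre.runs (x := x) (lam1 := lam1)
            (s := { s with reg := reg }) h2
            ⟨hI.arr_eq, f1, f2, f3, by simp only [f8]; linarith, by simp only [f8]; linarith, f6⟩
          have g1 : s'.reg .lo = reg .lo := h.reg_eq (by decide)
          have g2 : s'.reg .up = reg .up := h.reg_eq (by decide)
          have g3 : s'.reg .alpha = reg .alpha := h.reg_eq (by decide)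
          refine ⟨s', t, k, h, ?_⟩
          simp only [g1, g2, g3]
          exact ⟨f4, f5, f7, f8⟩
        have hpow : u / 2 ^ (j + 1) = 1 / 2 * (u / 2 ^ j) := by rw [pow_succ]; field_simp
        have e0 : (0 : Expr).eval s = 0 := by simp [Expr.eval]
        simp only [searchBody, Cmd.block, stepCmd, midpointCmd, runs_seq, runs_ite, runs_assign,
          runs_skip, Test.Holds, Test.Ok, Expr.eval_hSub, Expr.eval_hDiv, Expr.ok_hSub,
          Expr.ok_hDiv, Expr.eval, Expr.Ok, Nat.cast_zero, Nat.cast_one, Nat.cast_ofNat, true_and,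
          and_true, ne_eq, OfNat.ofNat_ne_zero, not_false_eq_true]
        refine ⟨fun hpos => ?_, fun hneg => ?_⟩
        · have ha := (hcase.resolve_right fun h => h.1 hpos).2
          apply hfin <;> simp only [Function.update_apply, reduceCtorEq, if_true, if_false]
          · exact hI.lam1_eq
          · exact hI.lam2_eq
          · exact hI.lo_nonneg.trans hI.lo_le
          · exact ha
          · exact hup
          · exact hI.up_lt
          · rw [hpow, ← hl', hα]; ring
        · have hb := (hcase.resolve_left fun h => hneg h.1).2
          apply hfin <;> simp only [Function.update_apply, reduceCtorEq, if_true, if_false]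
          · exact hI.lam1_eq
          · exact hI.lam2_eq
          · exact hI.lo_nonneg
          · exact hlo
          · exact hb
          · exact hI.up_lt.imp fun i hi => hI.le_up.trans_lt hi
          · rw [hpow, ← hl', hα]; ring
      have hI₁ := searchBody_always h2 hI _ _ _ h₁
      obtain ⟨A, hA⟩ := linCost_searchBody .bisection
      have hk₁ := (hA _ _ _ _ _ hn h₁).2
      obtain ⟨s₂, t₂, k₂, h₂, hle⟩ := ih (j + 1) s₁ hI₁ hb.1 hb.2.1 hb.2.2.1 hb.2.2.2
        (by rwa [add_assoc, add_comm 1 r])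
      refine ⟨s₂, _, _, .loopStep ⟨trivial, trivial⟩ hhold h₁ h₂, ?_⟩
      rwa [hk₁, ← add_assoc]
    · refine ⟨s, _, _, .loopDone ⟨trivial, trivial⟩ ?_, ?_⟩
      · simpa [Test.Holds, Expr.eval] using hf
      · simpa using hlen j s hlo hup hl'

theorem projCmd_bisection_runs {u a b : ℝ} (h1 : 0 < lam1) (h2 : 0 < lam2)
    (hx : ∀ i, 0 ≤ x i) (hne : ∃ i j, x i < x j)
    (hp : projSet (sparseSet n lam1 lam2) x = {p}) (h0 : 0 < auxPsi x lam1 lam2 0) (hn : 0 < n)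
    (hu : IsSecondMax x u) (hab : IsRootBracket x lam1 lam2 a b)
    (hs1 : s.reg .lam1 = lam1) (hs2 : s.reg .lam2 = lam2) (harr : ∀ i, s.arr i = x i) :
    ∃ s' t k, Exec (projCmd .bisection) s s' t k ∧ (k : ℝ) ≤ 2 + Real.logb 2 (u / (b - a)) := by
  obtain ⟨s₁, t₁, k₁, ha, hP, e1, e2, e3⟩ := auxCmd_zero_runs h2 hx hne hs1 hs2 harr
  obtain ⟨s₂, t₂, k₂, hb, f1, f2, f3⟩ := searchInit_runs hx hne e3
  have hup : s₂.reg .up = u := f2.unique hu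
  obtain ⟨s₃, t₃, k₃, hc, hI⟩ := (searchInit_pre hx hne e1 e2 e3 hb).runs h2
  have hlt : 0 < b - a := sub_pos.mpr hab.2.2.2.2.1
  have hbu : b ≤ u := hu.2 ⟨hab.2.1, hab.2.2.1⟩
  have ha0 : 0 ≤ a := hab.2.2.2.1
  have g1 : s₃.reg .lo = 0 := (hc.reg_eq (by decide)).trans f1
  have g2 : s₃.reg .up = u := (hc.reg_eq (by decide)).trans hup
  have g3 : s₃.reg .alpha = s₃.reg .lo + 1 / 2 * (s₃.reg .up - s₃.reg .lo) := by
    rw [hc.reg_eq (r := .alpha) (by decide), g1, g2, f3, f1, hup]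
  obtain ⟨r, hr⟩ := pow_unbounded_of_one_lt (u / (b - a)) one_lt_two
  rw [div_lt_iff₀ hlt] at hr
  obtain ⟨s₄, t₄, k₄, hd, hk⟩ := bisection_loop (u := u) h2 hn hab r 0 s₃ hI (by rw [g1]; exact ha0)
    (by rw [g2]; exact hbu) (by rw [g1, g2]; simp) g3 (by simpa using hr)
  obtain ⟨t₅, he⟩ := exec_searchCmd_iff.mpr ⟨_, _, _, _, _, _, _, _, hb, hc, hd, rfl⟩
  obtain ⟨hI₄, hf₄⟩ := searchCmd_always h2 hx hne e1 e2 e3 _ _ _ he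
  obtain ⟨s₆, t₆, k₆, hg, -⟩ := (hI₄.finalPre h1 h2 hf₄).runs h2 hp
  obtain ⟨t, H⟩ := exec_projCmd_iff.mpr ⟨_, _, _, _, _, _, _, _, ha,
    .iteFalse ⟨trivial, trivial⟩ (fun h => h0.not_ge ((psi_test rfl hP).mp h)) he, hg, rfl⟩
  refine ⟨s₆, t, _, H, ?_⟩
  obtain ⟨A, hA⟩ := linCost_auxCmd
  obtain ⟨B, hB⟩ := linCost_searchInit
  obtain ⟨C, hC⟩ := linCost_finalCmd
  rw [(hA _ _ _ _ _ hn ha).2, (hA _ _ _ _ _ hn hc).2, (hB _ _ _ _ _ hn hb).2,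
    (hC _ _ _ _ _ hn hg).2]
  have hlog : (k₄ : ℝ) ≤ Real.logb 2 (u / (b - a)) := by
    rw [Real.le_logb_iff_rpow_le one_lt_two (div_pos (by linarith) hlt), Real.rpow_natCast,
      le_div_iff₀ hlt]
    simpa using hk
  -- The `2` counts the evaluations at `0` and at the first midpoint.
  push_cast
  linarith

end Correct

theorem mainTheorem1 :
    ∃ C S : ℕ, ∀ solver : Solver, (projCmd solver).space ≤ S ∧
      ∀ (n : ℕ) (lam1 lam2 : ℝ) (x p : EuclideanSpace ℝ (Fin n)) (s : State n),
        0 < lam2 → lam2 < lam1 → lam1 < Real.sqrt n * lam2 →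
        (∀ i, 0 ≤ x i) →
        projSet (sparseSet n lam1 lam2) x = {p} →
        s.reg Reg.lam1 = lam1 → s.reg Reg.lam2 = lam2 → (∀ i, s.arr i = x i) →
        -- every run that halts returns the projection, in `O(n)` operations per evaluation of `Ψ`
        (∀ (s' : State n) (t k : ℕ), Exec (projCmd solver) s s' t k →
          (∀ i, s'.arr i = p i) ∧ t ≤ C * n * k) ∧
        -- where sparseness has to be decreased, one evaluation is enough
        (auxPsi x lam1 lam2 0 ≤ 0 →
          ∃ (s' : State n) (t : ℕ), Exec (projCmd solver) s s' t 1 ∧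
            (∀ i, s'.arr i = p i) ∧ t ≤ C * n) ∧
        -- where it has to be increased, bisection halts, and the number of evaluations is bounded
        -- through the relative length of the interval that has to be found
        (0 < auxPsi x lam1 lam2 0 → solver = Solver.bisection →
          (maxMult x : ℝ) * lam2 ^ 2 ≠ lam1 ^ 2 →
          ∃ (s' : State n) (t k : ℕ) (u a b : ℝ), Exec (projCmd solver) s s' t k ∧
            (∀ i, s'.arr i = p i) ∧
            IsSecondMax x u ∧ IsRootBracket x lam1 lam2 a b ∧
            (k : ℝ) ≤ 2 + Real.logb 2 (u / (b - a)) ∧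
            (t : ℝ) ≤ C * n * (2 + Real.logb 2 (u / (b - a)))) := by
  have hcost : ∀ solver, ∃ C : ℕ, ∀ (n : ℕ) (s s' : State n) (t k : ℕ), 0 < n →
      Exec (projCmd solver) s s' t k → t ≤ C * n * k := by
    intro solver
    obtain ⟨A, hA⟩ := probeCost_projCmd solver
    refine ⟨2 * A, fun n s s' t k hn h => ?_⟩
    obtain ⟨h₁, h₂⟩ := hA _ _ _ _ _ hn h
    -- Every run passes at least one probe, so `k + 1 ≤ 2 * k`.
    calc t ≤ A * n * (k + 1) := h₁
      _ ≤ A * n * (2 * k) := by gcongr; omega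
      _ = 2 * A * n * k := by ring
  choose C hC using hcost
  have hsum : ∀ (f : Solver → ℕ) (solver : Solver),
      f solver ≤ f .bisection + f .newton + f .newtonSqr + f .halley := by
    intro f solver
    cases solver <;> omega
  -- Summing over the four solvers makes both constants independent of the solver.
  refine ⟨C .bisection + C .newton + C .newtonSqr + C .halley,
    (projCmd .bisection).space + (projCmd .newton).space + (projCmd .newtonSqr).space +
      (projCmd .halley).space, fun solver => ⟨hsum (fun σ => (projCmd σ).space) solver, ?_⟩⟩
  intro n lam1 lam2 x p s h2 h21 h1n hx hp hs1 hs2 harr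
  have h1 : 0 < lam1 := h2.trans h21
  have hn : 0 < n := by
    rcases Nat.eq_zero_or_pos n with rfl | hn
    · simp at h1n; linarith
    · exact hn
  have hne := exists_lt_of_projSet_eq_singleton h2 h21 h1n hp
  have hall : ∀ (s' : State n) (t k : ℕ), Exec (projCmd solver) s s' t k →
      (∀ i, s'.arr i = p i) ∧
        t ≤ (C .bisection + C .newton + C .newtonSqr + C .halley) * n * k := by
    intro s' t k h
    refine ⟨projCmd_always h1 h2 h1n hx hne hp hs1 hs2 harr _ _ _ h,
      (hC solver n s s' t k hn h).trans ?_⟩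
    gcongr
    exact hsum C solver
  refine ⟨hall, fun h0 => ?_, fun h0 hsol hm => ?_⟩
  · obtain ⟨s', t, h⟩ := projCmd_runs_of_nonpos h1 h2 h1n hx hne hp h0 hn hs1 hs2 harr
    obtain ⟨h₁, h₂⟩ := hall s' t 1 h
    exact ⟨s', t, h, h₁, by simpa using h₂⟩
  · subst hsol
    obtain ⟨u, hu⟩ := exists_isSecondMax hne
    have hneg := auxPsi_secondMax_neg h1 h2 (lt_of_le_of_ne (maxMult_mul_sq_le h2 h21 hp) hm) hu
    obtain ⟨a, b, hab⟩ := exists_isRootBracket hx h0 hu hneg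
    obtain ⟨s', t, k, h, hk⟩ := projCmd_bisection_runs h1 h2 hx hne hp h0 hn hu hab hs1 hs2 harr
    obtain ⟨h₁, h₂⟩ := hall s' t k h
    refine ⟨s', t, k, u, a, b, h, h₁, hu, hab, hk, ?_⟩
    calc (t : ℝ) ≤ ((C .bisection + C .newton + C .newtonSqr + C .halley) * n * k : ℕ) := by
          exact_mod_cast h₂
      _ = ((C .bisection + C .newton + C .newtonSqr + C .halley : ℕ) : ℝ) * n * k := by
          push_cast
          ring
      _ ≤ _ := by gcongr
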